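/- **Unrelated machine scheduling with startup costs (UMSC).** There are $m\ge 2$ machines; machine $i$ has a startup cost $c_i\ge 0$. A sequence of $n\ge 1$ jobs arrives online; when job $j$ arrives, its processing times $p_{ij}\in[0,\infty]$ on the machines $i=1,\dots,m$ are revealed, and the job must be assigned irrevocably to one machine. The load $L_i$ of machine $i$ is the sum of $p_{ij}$ over the jobs $j$ assigned to $i$; the cost of a schedule is the sum of $c_i$ over the machines $i$ that receive at least one job; and, for fixed $p\ge 1$, the $\ell_p$ norm of the loads is $\bigl(\sum_i L_i^p\bigr)^{1/p}$. The algorithm knows in advance $m$, the costs $c_i$, the exponent $p$ and two numbers $\mathbf C,\mathbf L\ge 0$ with the promise that some schedule of all the jobs has cost at most $\mathbf C$ and $\ell_p$ norm at most $\mathbf L$; it knows neither the jobs that are still to come nor their number. **Theorem.** There are absolute constants $K_1,K_2>0$ such that for every real $p\ge 1$ there is a randomized online algorithm for UMSC that, on every input as above (fixed independently of the random choices of the algorithm), produces a schedule with $$\mathbb E[\text{cost}]\le K_1\,\log m\,\log(mn)\cdot\mathbf C\qquad\text{and}\qquad \mathbb E\Bigl[\bigl(\textstyle\sum_i L_i^p\bigr)^{1/p}\Bigr]\le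 K_2\,p^2\,\log^{1/p}(mn)\cdot\mathbf L .$$ That is, its bicriteria competitive ratio is $\bigl(O(\log m\log(mn)),\,O(p^2\log^{1/p}(mn))\bigr)$, with constants independent of $p$, $m$, $n$ and the instance. -/

import Mathlib

open MeasureTheory
open scoped ENNReal NNReal

namespace UMSC

/-- What is revealed when a job arrives: its processing time on each of the `m` machines.
The value `∞` means that the job cannot be processed on that machine. -/
abbrev Job (m : ℕ) : Type := Fin m → ℝ≥0∞

/-- A schedule of `n` jobs on `m` machines assigns every job to one machine. -/
abbrev Schedule (n m : ℕ) : Type := Fin n → Fin m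

/-- The load of machine `i`: the total processing time of the jobs assigned to it. -/
noncomputable def load {n m : ℕ} (jobs : Fin n → Job m) (σ : Schedule n m) (i : Fin m) : ℝ≥0∞ :=
  ∑ j with σ j = i, jobs j i

/-- The open machines: those to which at least one job is assigned. -/
def openMachines {n m : ℕ} (σ : Schedule n m) : Finset (Fin m) :=
  Finset.univ.image σ

/-- The cost of a schedule: the sum of the startup costs of the open machines. -/
noncomputable def cost {n m : ℕ} (c : Fin m → ℝ≥0) (σ : Schedule n m) : ℝ≥0 :=
  ∑ i ∈ openMachines σ, c i

/-- The `ℓ_p` norm of the machine loads. -/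
noncomputable def loadNorm {n m : ℕ} (p : ℝ) (jobs : Fin n → Job m) (σ : Schedule n m) : ℝ≥0∞ :=
  (∑ i, load jobs σ i ^ p) ^ (1 / p)

/-- The pair `(C, L)` is a valid promise for the job sequence: some schedule has cost at most `C`
and `ℓ_p` norm of the loads at most `L`. -/
def Promise {n m : ℕ} (c : Fin m → ℝ≥0) (p : ℝ) (C L : ℝ≥0) (jobs : Fin n → Job m) : Prop :=
  ∃ σ : Schedule n m, cost c σ ≤ C ∧ loadNorm p jobs σ ≤ L

/-- A randomized online algorithm for `m` machines: a random seed `ω` is drawn from a probability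
space, and the `k`-th job (counted from `0`) is irrevocably assigned to a machine on arrival, as a
function of the jobs `0, …, k` that have arrived so far and of the seed. In particular the number
of jobs still to come is not known to the algorithm. -/
structure RandomizedOnlineAlgorithm (m : ℕ) where
  /-- the random seeds -/
  Ω : Type
  /-- the measurable sets of seeds -/
  measurableSpace : MeasurableSpace Ω
  /-- the law of the seed -/
  μ : Measure Ω
  isProbabilityMeasure : IsProbabilityMeasure μ
  /-- the machine chosen for the last one of the `k + 1` jobs that have arrived -/
  assign : (k : ℕ) → (Fin (k + 1) → Job m) → Ω → Fin m
  measurable_assign : ∀ (k : ℕ) (seen : Fin (k + 1) → Job m), Measurable (assign k seen)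

attribute [instance] RandomizedOnlineAlgorithm.measurableSpace
attribute [instance] RandomizedOnlineAlgorithm.isProbabilityMeasure

namespace RandomizedOnlineAlgorithm

variable {m n : ℕ}

/-- The schedule produced on a job sequence with a given seed. -/
def schedule (A : RandomizedOnlineAlgorithm m) (jobs : Fin n → Job m) (ω : A.Ω) :
    Schedule n m :=
  fun j => A.assign j (fun i => jobs ⟨i, lt_of_lt_of_le i.isLt j.isLt⟩) ω

/-- The expected cost of the schedule produced on a job sequence. -/
noncomputable def expectedCost (A : RandomizedOnlineAlgorithm m) (c : Fin m → ℝ≥0)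
    (jobs : Fin n → Job m) : ℝ≥0∞ :=
  ∫⁻ ω, (cost c (A.schedule jobs ω) : ℝ≥0∞) ∂A.μ

/-- The expected `ℓ_p` norm of the machine loads of the schedule produced on a job sequence. -/
noncomputable def expectedLoadNorm (A : RandomizedOnlineAlgorithm m) (p : ℝ)
    (jobs : Fin n → Job m) : ℝ≥0∞ :=
  ∫⁻ ω, loadNorm p jobs (A.schedule jobs ω) ∂A.μ

end RandomizedOnlineAlgorithm

end UMSC

/-! The proof is a primal-dual fractional algorithm followed by threshold rounding and a greedy
choice. Costs are measured relative to `C`, processing times relative to `17 * p * L`.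

Fractionally, machine `i` collects payments `P i`, of which `V i` pays for load and the rest is
surplus, and it is open to the extent `min 1 (m ^ (P i / κ i - 1))`. A job raises its price until
its shares, weighted by the openings, add up to one. A machine with increment `a` starts to take a
share at price `a`, takes the whole job at `2 * a`, and keeps the excess over `2 * a` as surplus.
The prices act as dual variables: along the promised schedule, each price is at most surplus plus
twice the increment there, surpluses at a machine stay below its scaled cost, and the increments are
absorbed by an eighth of `V` plus the promised load. Since `V` itself is charged to the prices, the
total price is at most 6 (`FracRun.sum_price_le`). Exponential opening turns this into fractional
cost `O(log m)` (`FracRun.sum_scaled_cost_le`).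

For the rounding, each machine draws one uniform threshold and opens when `8 * log (m * (k + 1))`
times its opening reaches it. A Chernoff bound shows that the open machines hold at least half of
job `k` except with probability `(m * (k + 1)) ^ (-2)`. These probabilities sum to at most 1, so
sending each exceptional job to any eligible machine costs at most `C` and `L` in expectation.

Covered jobs go greedily to an open machine with the least increase of the sum of `p`-th powers. For
every outcome of the thresholds, `greedy_sum_le` bounds this sum by `3 * (17 * p) ^ p` times the
fractional increments at open machines. The comparison of increments at actual loads with increments
at fractional loads is Minkowski's inequality (`sum_powInc_le`). The resulting bound is linear in
the indicators of openness, so its expectation is `O(log (m * n))` without any independence between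
jobs. The `p`-th root gives `log ^ (1 / p)`; one factor `p` comes from the scaling of sizes and one
from the greedy comparison. -/

namespace UMSC

/-! ### Increments of the `p`-th power -/

/-- The increase of `s ^ p` when `s` grows by `q`. -/
noncomputable def powInc (p s q : ℝ) : ℝ := (s + q) ^ p - s ^ p

lemma powInc_nonneg {p s q : ℝ} (hp : 1 ≤ p) (hs : 0 ≤ s) (hq : 0 ≤ q) : 0 ≤ powInc p s q :=
  sub_nonneg.2 (Real.rpow_le_rpow hs (by linarith) (by linarith))

/-- Convexity of the power: `s + q` and `t` are complementary convex combinations of the extreme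
points `s` and `t + q`. -/
lemma powInc_mono {p s t q : ℝ} (hp : 1 ≤ p) (hs : 0 ≤ s) (hst : s ≤ t) (hq : 0 ≤ q) :
    powInc p s q ≤ powInc p t q := by
  unfold powInc
  rcases hst.eq_or_lt with rfl | hlt
  · exact le_rfl
  have hd : 0 < t + q - s := by linarith
  have hconv := convexOn_rpow hp
  set μ := q / (t + q - s)
  have hμ : μ * (t + q - s) = q := div_mul_cancel₀ _ hd.ne'
  have hμ0 : 0 ≤ μ := by positivity
  have hμ1 : μ ≤ 1 := (div_le_one hd).2 (by linarith)
  have hs' : s ∈ Set.Ici (0 : ℝ) := hs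
  have ht' : t + q ∈ Set.Ici (0 : ℝ) := Set.mem_Ici.2 (by linarith)
  have h1 := hconv.2 hs' ht' (sub_nonneg.2 hμ1) hμ0 (by ring)
  have h2 := hconv.2 hs' ht' hμ0 (sub_nonneg.2 hμ1) (by ring)
  simp only [smul_eq_mul] at h1 h2
  rw [show (1 - μ) * s + μ * (t + q) = s + q by linear_combination hμ] at h1
  rw [show μ * s + (1 - μ) * (t + q) = t by linear_combination -hμ] at h2
  linarith

/-- If `s ≥ 16 * p * l`, the relative growth is at most `(1 + 1 / (16 * p)) ^ p ≤ exp (1 / 16) ≤ 9 /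
8`; otherwise `s + l ≤ 17 * p * l`. The factor `1 / 8` is small enough to be absorbed in both later
self-referential estimates. -/
lemma powInc_le {p s l : ℝ} (hp : 1 ≤ p) (hs : 0 ≤ s) (hl : 0 ≤ l) :
    powInc p s l ≤ s ^ p / 8 + (17 * p * l) ^ p := by
  unfold powInc
  have hp0 : 0 < p := by linarith
  rcases le_or_gt (16 * p * l) s with h | h
  · have h1 : s + l ≤ s * (1 + 1 / (16 * p)) := by
      have : l ≤ s * (1 / (16 * p)) := by
        rw [mul_one_div, le_div_iff₀ (by positivity)]; linarith
      linarith
    have h2 : (1 + 1 / (16 * p)) ^ p ≤ 9 / 8 := by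
      have h3 : 1 + 1 / (16 * p) ≤ Real.exp (1 / (16 * p)) := by
        have := Real.add_one_le_exp (1 / (16 * p)); linarith
      calc (1 + 1 / (16 * p)) ^ p ≤ (Real.exp (1 / (16 * p))) ^ p :=
            Real.rpow_le_rpow (by positivity) h3 hp0.le
        _ = Real.exp (1 / 16) := by
            rw [← Real.exp_mul]; congr 1; field_simp
        _ ≤ 9 / 8 := by
            have := Real.add_one_le_exp (-(1 / 16 : ℝ))
            rw [Real.exp_neg] at this
            have h4 := Real.exp_pos (1 / 16 : ℝ)
            have h5 : Real.exp (1 / 16) * (15 / 16) ≤ 1 := by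
              calc Real.exp (1 / 16) * (15 / 16)
                  ≤ Real.exp (1 / 16) * (Real.exp (1 / 16))⁻¹ := by gcongr; linarith
                _ = 1 := mul_inv_cancel₀ h4.ne'
            linarith
    have h6 : (s + l) ^ p ≤ s ^ p * (9 / 8) := by
      calc (s + l) ^ p ≤ (s * (1 + 1 / (16 * p))) ^ p :=
            Real.rpow_le_rpow (by positivity) h1 hp0.le
        _ = s ^ p * (1 + 1 / (16 * p)) ^ p := Real.mul_rpow hs (by positivity)
        _ ≤ _ := by gcongr
    have : 0 ≤ (17 * p * l) ^ p := by positivity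
    linarith
  · have h1 : (s + l) ^ p ≤ (17 * p * l) ^ p :=
      Real.rpow_le_rpow (by positivity) (by nlinarith) hp0.le
    have : 0 ≤ s ^ p := by positivity
    linarith

/-- Minkowski's inequality for a two-point distribution. -/
lemma two_point_minkowski {p z l t u : ℝ} (hp : 1 ≤ p) (hz0 : 0 ≤ z) (hz1 : z ≤ 1) (hl : 0 ≤ l)
    (ht : 0 ≤ t) (hu : 0 ≤ u) :
    (1 - z) * (l + t) ^ p + z * (l + u) ^ p ≤ (l + ((1 - z) * t ^ p + z * u ^ p) ^ (1 / p)) ^ p := by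
  have hp0 : 0 < p := by linarith
  have hz' : 0 ≤ 1 - z := by linarith
  have key : ∀ w : ℝ, 0 ≤ w → ∀ v : ℝ, 0 ≤ v → (w ^ (1 / p) * v) ^ p = w * v ^ p := by
    intro w hw v hv
    rw [Real.mul_rpow (by positivity) hv, ← Real.rpow_mul hw, one_div_mul_cancel hp0.ne',
      Real.rpow_one]
  -- The probabilities `1 - z` and `z` enter the counting `ℓ_p` norm as their `p`-th roots.
  have h := Real.Lp_add_le_of_nonneg (Finset.univ : Finset (Fin 2))
    (f := ![(1 - z) ^ (1 / p) * l, z ^ (1 / p) * l])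
    (g := ![(1 - z) ^ (1 / p) * t, z ^ (1 / p) * u]) hp
    (by intro i _; fin_cases i <;> simp <;> positivity)
    (by intro i _; fin_cases i <;> simp <;> positivity)
  simp only [Fin.sum_univ_two, Matrix.cons_val_zero, Matrix.cons_val_one,
    ← mul_add] at h
  rw [key _ hz' _ (by positivity), key _ hz0 _ (by positivity), key _ hz' _ hl, key _ hz0 _ hl,
    key _ hz' _ ht, key _ hz0 _ hu, ← add_mul, sub_add_cancel, one_mul,
    one_div, Real.rpow_rpow_inv hl hp0.ne'] at h
  calc (1 - z) * (l + t) ^ p + z * (l + u) ^ p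
      = (((1 - z) * (l + t) ^ p + z * (l + u) ^ p) ^ p⁻¹) ^ p := by
        rw [Real.rpow_inv_rpow (by positivity) hp0.ne']
    _ ≤ _ := by
        rw [one_div]
        exact Real.rpow_le_rpow (by positivity) h hp0.le

/-- Increments at a fixed load are dominated by the increment by the `ℓ_p` sum of the increments
along any sequence of larger reference values. -/
lemma sum_powInc_le {p l : ℝ} (hp : 1 ≤ p) (hl : 0 ≤ l) (n : ℕ) (z q V : ℕ → ℝ)
    (hz0 : ∀ k < n, 0 ≤ z k) (hz1 : ∀ k < n, z k ≤ 1) (hq : ∀ k < n, 0 ≤ q k)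
    (hV : ∀ k < n, ∑ j ∈ Finset.range k, z j * powInc p (V j ^ (1 / p)) (q j) ≤ V k)
    (hV0 : ∀ k < n, 0 ≤ V k) :
    l ^ p + ∑ j ∈ Finset.range n, z j * powInc p l (q j) ≤
      (l + (∑ j ∈ Finset.range n, z j * powInc p (V j ^ (1 / p)) (q j)) ^ (1 / p)) ^ p := by
  have hp0 : 0 < p := by linarith
  induction n with
  | zero => simp [Real.zero_rpow (inv_ne_zero hp0.ne')]
  | succ n ih =>
    have ih := ih (fun k hk => hz0 k (by omega)) (fun k hk => hz1 k (by omega))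
      (fun k hk => hq k (by omega)) (fun k hk => hV k (by omega)) (fun k hk => hV0 k (by omega))
    rw [Finset.sum_range_succ, Finset.sum_range_succ]
    set T := ∑ j ∈ Finset.range n, z j * powInc p (V j ^ (1 / p)) (q j) with hT
    have hTV : T ≤ V n := hV n (by omega)
    have hz0n := hz0 n (by omega)
    have hz1n := hz1 n (by omega)
    have hqn := hq n (by omega)
    have hT0 : 0 ≤ T := Finset.sum_nonneg fun j hj => by
      have hj' := Finset.mem_range.1 hj
      exact mul_nonneg (hz0 j (by omega))
        (powInc_nonneg hp (Real.rpow_nonneg (hV0 j (by omega)) _) (hq j (by omega)))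
    set t := T ^ (1 / p) with ht
    have ht0 : 0 ≤ t := by positivity
    have htp : t ^ p = T := by rw [ht, one_div, Real.rpow_inv_rpow hT0 hp0.ne']
    -- Let `X` be `t + q n` with probability `z n` and `t` otherwise. Raising the base point to `l +
    -- t` makes the new left side `E (l + X) ^ p`, and Minkowski bounds it by the norm of `X`, whose
    -- `p`-th moment is at most the new sum.
    have h1 : powInc p l (q n) ≤ powInc p (l + t) (q n) := powInc_mono hp hl (by linarith) hqn
    have h2 := two_point_minkowski hp hz0n hz1n hl ht0 (add_nonneg ht0 hqn)
    have h3 : (1 - z n) * t ^ p + z n * (t + q n) ^ p ≤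
        T + z n * powInc p (V n ^ (1 / p)) (q n) := by
      have h4 : powInc p t (q n) ≤ powInc p (V n ^ (1 / p)) (q n) :=
        powInc_mono hp ht0 (Real.rpow_le_rpow hT0 hTV (by positivity)) hqn
      have h5 := mul_le_mul_of_nonneg_left h4 hz0n
      have h6 : z n * powInc p t (q n) = z n * (t + q n) ^ p - z n * t ^ p := by
        unfold powInc; ring
      linarith
    have hpos : 0 ≤ (1 - z n) * t ^ p + z n * (t + q n) ^ p := by
      have : 0 ≤ 1 - z n := by linarith
      positivity
    calc _ ≤ (l + t) ^ p + z n * powInc p (l + t) (q n) := by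
          have := mul_le_mul_of_nonneg_left h1 hz0n
          linarith
      _ = (1 - z n) * (l + t) ^ p + z n * (l + (t + q n)) ^ p := by unfold powInc; ring_nf
      _ ≤ _ := h2
      _ ≤ _ := by gcongr

/-- Successive increments add up to at most the total increment at a larger starting point. -/
lemma sum_powInc_le_powInc_sum {ι : Type*} {p t : ℝ} (hp : 1 ≤ p) (S : Finset ι) (s q : ι → ℝ)
    (hs : ∀ j ∈ S, 0 ≤ s j) (hst : ∀ j ∈ S, s j ≤ t) (hq : ∀ j ∈ S, 0 ≤ q j) :
    ∑ j ∈ S, powInc p (s j) (q j) ≤ powInc p t (∑ j ∈ S, q j) := by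
  classical
  induction S using Finset.induction_on with
  | empty => simp [powInc]
  | insert a S ha ih =>
    have ih := ih (fun j hj => hs j (Finset.mem_insert_of_mem hj))
      (fun j hj => hst j (Finset.mem_insert_of_mem hj))
      (fun j hj => hq j (Finset.mem_insert_of_mem hj))
    rw [Finset.sum_insert ha, Finset.sum_insert ha]
    have hS : 0 ≤ ∑ j ∈ S, q j :=
      Finset.sum_nonneg fun j hj => hq j (Finset.mem_insert_of_mem hj)
    have ha' := Finset.mem_insert_self a S
    have h1 : powInc p (s a) (q a) ≤ powInc p (t + ∑ j ∈ S, q j) (q a) :=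
      powInc_mono hp (hs a ha') (by linarith [hst a ha']) (hq a ha')
    have h2 : powInc p t (q a + ∑ j ∈ S, q j) =
        powInc p t (∑ j ∈ S, q j) + powInc p (t + ∑ j ∈ S, q j) (q a) := by
      unfold powInc; ring_nf
    linarith

/-! ### Pricing a single job -/

/-- The fractional opening of a machine of scaled cost `κ` which has received payments `P`. -/
noncomputable def opening (m : ℕ) (κ P : ℝ) : ℝ := min 1 (Real.exp (Real.log m * (P / κ - 1)))

/-- The fraction of a job that a machine with increment `a` takes at price `t`. -/
noncomputable def share (a t : ℝ) : ℝ := if a = 0 then 1 else max 0 (min 1 (t / a - 1))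

lemma continuous_share (a : ℝ) : Continuous (share a) := by
  unfold share
  split_ifs <;> fun_prop

lemma share_nonneg (a t : ℝ) : 0 ≤ share a t := by
  unfold share; split_ifs <;> simp

lemma share_le_one (a t : ℝ) : share a t ≤ 1 := by
  unfold share; split_ifs <;> simp

lemma share_eq_one {a t : ℝ} (ha : 0 ≤ a) (h : 2 * a ≤ t) : share a t = 1 := by
  unfold share
  split_ifs with h0
  · rfl
  · have ha' : 0 < a := lt_of_le_of_ne ha (Ne.symm h0)
    have : 2 ≤ t / a := (le_div_iff₀ ha').2 h
    rw [min_eq_left (by linarith), max_eq_right zero_le_one]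

/-- The ramp of the share ends exactly where the surplus starts. Above `2 * a` the share is 1 and
the payment is `t - a`; below, there is no surplus, and a positive share forces `a ≤ t`. -/
lemma share_pay_le {a t : ℝ} (ha : 0 ≤ a) (ht : 0 ≤ t) :
    max 0 (t - 2 * a) + share a t * a ≤ t * share a t := by
  rcases le_or_gt (2 * a) t with h | h
  · rw [share_eq_one ha h, max_eq_right (by linarith)]; linarith
  · rw [max_eq_left (by linarith)]
    have ha' : 0 < a := by linarith
    rcases (share_nonneg a t).eq_or_lt with h0 | h0
    · rw [← h0]; simp
    · have : a ≤ t := by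
        by_contra hlt
        have h1 : t / a ≤ 1 := (div_le_one ha').2 (by linarith)
        unfold share at h0
        rw [if_neg ha'.ne', max_eq_left ((min_le_right _ _).trans (by linarith))] at h0
        exact lt_irrefl _ h0
      nlinarith

/-- The properties of the price `t`, the shares `z` and the surpluses `β` chosen for one job. -/
structure IsPricing {m : ℕ} (κ P a : Fin m → ℝ) (el : Fin m → Prop) (t : ℝ) (z β : Fin m → ℝ) :
    Prop where
  price_nonneg : 0 ≤ t
  share_nonneg : ∀ i, 0 ≤ z i
  share_le_one : ∀ i, z i ≤ 1
  eligible : ∀ i, 0 < z i → el i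
  surplus_nonneg : ∀ i, 0 ≤ β i
  pay_le : ∀ i, β i + z i * a i ≤ t * z i
  price_le : ∀ i, el i → t ≤ β i + 2 * a i
  paid_le : ∀ i, 0 < β i → P i + (β i + z i * a i) ≤ κ i
  one_le : 1 ≤ ∑ i, opening m (κ i) (P i + (β i + z i * a i)) * z i
  price_mul_le : t * ∑ i, opening m (κ i) (P i + (β i + z i * a i)) * z i ≤ t

lemma opening_nonneg (m : ℕ) (κ P : ℝ) : 0 ≤ opening m κ P :=
  le_min zero_le_one (Real.exp_pos _).le

lemma opening_le_one (m : ℕ) (κ P : ℝ) : opening m κ P ≤ 1 := min_le_left _ _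

lemma opening_eq_one {m : ℕ} {κ P : ℝ} (hκ : 0 < κ) (h : κ ≤ P) : opening m κ P = 1 := by
  refine min_eq_left (Real.one_le_exp ?_)
  have : 1 ≤ P / κ := (one_le_div hκ).2 h
  exact mul_nonneg (Real.log_natCast_nonneg m) (by linarith)

/-- The price is the least `t ≥ 0` at which the opened shares reach 1. All quantities are continuous
in `t`, so the least price exists, and minimality limits both the coverage and the payments to
machines with surplus. -/
lemma exists_isPricing {m : ℕ} {κ P a : Fin m → ℝ} {el : Fin m → Prop}
    (hκ : ∀ i, 0 < κ i) (hP : ∀ i, 0 ≤ P i) (ha : ∀ i, 0 ≤ a i) (hel : ∃ i, el i) :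
    ∃ t z β, IsPricing κ P a el t z β := by
  classical
  set z : ℝ → Fin m → ℝ := fun t i => if el i then share (a i) t else 0 with hz
  set β : ℝ → Fin m → ℝ := fun t i => if el i then max 0 (t - 2 * a i) else 0 with hβ
  set f : ℝ → ℝ := fun t => ∑ i, opening m (κ i) (P i + (β t i + z t i * a i)) * z t i with hf
  have hzc : ∀ i, Continuous fun t => z t i := fun i => by
    simp only [hz]; split_ifs
    · exact continuous_share _
    · exact continuous_const
  have hβc : ∀ i, Continuous fun t => β t i := fun i => by
    simp only [hβ]; split_ifs <;> fun_prop
  have hfc : Continuous f := by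
    refine continuous_finsetSum _ fun i _ => ?_
    have := hzc i
    have := hβc i
    unfold opening
    fun_prop
  have hz0 : ∀ t i, 0 ≤ z t i := fun t i => by
    simp only [hz]; split_ifs
    · exact share_nonneg _ _
    · exact le_rfl
  have hterm : ∀ t i, 0 ≤ opening m (κ i) (P i + (β t i + z t i * a i)) * z t i :=
    fun t i => mul_nonneg (opening_nonneg _ _ _) (hz0 t i)
  have hbig : ∀ t i, el i → 2 * a i ≤ t → κ i ≤ P i + (t - a i) → 1 ≤ f t := by
    intro t i hi h1 h2
    refine le_trans (le_of_eq ?_)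
      (Finset.single_le_sum (fun j _ => hterm t j) (Finset.mem_univ i))
    have h3 : z t i = 1 := by simp only [hz, if_pos hi]; exact share_eq_one (ha i) h1
    have h4 : β t i = t - 2 * a i := by
      simp only [hβ, if_pos hi]; exact max_eq_right (by linarith)
    rw [h3, h4, opening_eq_one (hκ i) (by linarith), one_mul]
  set S : Set ℝ := {t | 0 ≤ t ∧ 1 ≤ f t} with hS
  have hSne : S.Nonempty := by
    obtain ⟨i, hi⟩ := hel
    have := hκ i
    have := ha i
    have := hP i
    exact ⟨2 * a i + κ i, by positivity, hbig _ i hi (by linarith) (by linarith)⟩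
  have hSc : IsClosed S :=
    (isClosed_le continuous_const continuous_id).inter (isClosed_le continuous_const hfc)
  have hSb : BddBelow S := ⟨0, fun t ht => ht.1⟩
  set t₀ := sInf S
  have ht₀ : t₀ ∈ S := hSc.csInf_mem hSne hSb
  have hmin : ∀ t, 0 ≤ t → t < t₀ → f t < 1 := fun t h0 hlt => by
    by_contra hge
    exact absurd (csInf_le hSb ⟨h0, not_lt.1 hge⟩) (not_le.2 hlt)
  refine ⟨t₀, z t₀, β t₀, ht₀.1, hz0 t₀, ?_, ?_, ?_, ?_, ?_, ?_, ht₀.2, ?_⟩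
  · intro i
    simp only [hz]; split_ifs
    · exact share_le_one _ _
    · exact zero_le_one
  · intro i hi
    by_contra hn
    simp [hz, hn] at hi
  · intro i
    simp only [hβ]; split_ifs
    · exact le_max_left _ _
    · exact le_rfl
  · intro i
    simp only [hβ, hz]; split_ifs
    · exact share_pay_le (ha i) ht₀.1
    · simp
  · intro i hi
    simp only [hβ, if_pos hi]
    have := le_max_right 0 (t₀ - 2 * a i)
    linarith
  · intro i hi
    have hei : el i := by
      by_contra hn
      simp [hβ, hn] at hi
    have hlt : 2 * a i < t₀ := by
      by_contra hn
      simp only [hβ, if_pos hei, max_eq_left (show t₀ - 2 * a i ≤ 0 by linarith)] at hi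
      exact lt_irrefl _ hi
    have h3 : z t₀ i = 1 := by simp only [hz, if_pos hei]; exact share_eq_one (ha i) hlt.le
    have h4 : β t₀ i = t₀ - 2 * a i := by
      simp only [hβ, if_pos hei]; exact max_eq_right (by linarith)
    rw [h3, h4]
    -- At a smaller price above `2 * a i`, machine `i` would have share 1 and payment `t - a i`; had
    -- this filled it up to `κ i`, that machine alone would cover the job, against minimality.
    have h5 : t₀ ≤ κ i - P i + a i := by
      refine le_of_forall_lt_imp_le_of_dense fun t ht => ?_
      rcases le_or_gt t (2 * a i) with h6 | h6
      · refine h6.trans ?_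
        obtain ⟨u, hu1, hu2⟩ := exists_between hlt
        by_contra hn
        have := ha i
        exact absurd (hbig u i hei hu1.le (by linarith)) (not_le.2 (hmin u (by linarith) hu2))
      · by_contra hn
        have := ha i
        exact absurd (hbig t i hei h6.le (by linarith)) (not_le.2 (hmin t (by linarith) ht))
    linarith
  · change t₀ * f t₀ ≤ t₀
    -- At price 0 coverage may exceed 1, but the product vanishes. At a positive price, overshooting
    -- would yield an earlier crossing by the intermediate value theorem.
    rcases ht₀.1.eq_or_lt with h0 | h0
    · rw [← h0]; simp
    · have : f t₀ ≤ 1 := by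
        by_contra hgt
        have hgt := not_le.1 hgt
        obtain ⟨t, ⟨h1, h2⟩, h3⟩ := intermediate_value_Icc ht₀.1 hfc.continuousOn
          ⟨(hmin 0 le_rfl h0).le, hgt.le⟩
        rcases h2.eq_or_lt with h4 | h4
        · rw [h4] at h3; linarith
        · have := hmin t h1 h4; linarith
      nlinarith

/-- From `exp v - exp u ≤ exp v * (v - u)`, truncated at 1. The factor is the opening after payment,
the same one that is used in the coverage condition. -/
lemma opening_sub_le {m : ℕ} {κ P Q : ℝ} (hκ : 0 < κ) (hPQ : P ≤ Q) :
    κ * (opening m κ Q - opening m κ P) ≤ Real.log m * (opening m κ Q * (Q - P)) := by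
  have hlog : 0 ≤ Real.log m := Real.log_natCast_nonneg m
  set u := Real.log m * (P / κ - 1) with hu
  set v := Real.log m * (Q / κ - 1) with hv
  have hvu : κ * (v - u) = Real.log m * (Q - P) := by rw [hu, hv]; field_simp; ring
  have huv : 0 ≤ v - u := by
    have : 0 ≤ κ * (v - u) := by rw [hvu]; exact mul_nonneg hlog (by linarith)
    exact nonneg_of_mul_nonneg_right this hκ
  have hQ : opening m κ Q = min 1 (Real.exp v) := rfl
  have hP : opening m κ P = min 1 (Real.exp u) := rfl
  suffices h : min 1 (Real.exp v) - min 1 (Real.exp u) ≤ min 1 (Real.exp v) * (v - u) by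
    rw [hQ, hP]
    calc _ ≤ κ * (min 1 (Real.exp v) * (v - u)) := by gcongr
      _ = min 1 (Real.exp v) * (κ * (v - u)) := by ring
      _ = _ := by rw [hvu]; ring
  rcases le_or_gt 0 u with h0 | h0
  · rw [min_eq_left (Real.one_le_exp h0), min_eq_left (Real.one_le_exp (by linarith))]
    linarith
  · have h1 : min 1 (Real.exp v) = Real.exp (min 0 v) := by
      rw [← Real.exp_zero, Real.exp_monotone.map_min]
    rw [h1, min_eq_right (Real.exp_le_one_iff.2 h0.le)]
    have h2 : Real.exp u = Real.exp (min 0 v) * Real.exp (u - min 0 v) := by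
      rw [← Real.exp_add]; ring_nf
    have h3 := Real.add_one_le_exp (u - min 0 v)
    have h4 : min 0 v ≤ v := min_le_right _ _
    have h5 := Real.exp_pos (min 0 v)
    rw [h2]
    nlinarith

lemma opening_mono {m : ℕ} {κ P Q : ℝ} (hκ : 0 < κ) (hPQ : P ≤ Q) :
    opening m κ P ≤ opening m κ Q := by
  unfold opening
  have := Real.log_natCast_nonneg m
  gcongr

lemma le_of_opening_ne_one {m : ℕ} {κ P : ℝ} (hκ : 0 < κ) (h : opening m κ P ≠ 1) : P ≤ κ := by
  by_contra hlt
  exact h (opening_eq_one hκ (by linarith))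

lemma opening_zero {m : ℕ} (hm : 0 < m) (κ : ℝ) : opening m κ 0 = 1 / m := by
  have hm' : (0 : ℝ) < m := Nat.cast_pos.2 hm
  have h1 : (1 : ℝ) ≤ m := Nat.one_le_cast.2 hm
  unfold opening
  rw [zero_div, zero_sub, mul_neg_one, Real.exp_neg, Real.exp_log hm', one_div]
  exact min_eq_right (inv_le_one_of_one_le₀ h1)

/-! ### Primal-dual analysis of the fractional algorithm -/

/-- A run of the fractional algorithm on `n` jobs: `P` are the payments received by the machines,
`V` the parts of them that pay for load. -/
structure FracRun {m : ℕ} (p : ℝ) (n : ℕ) (κ : Fin m → ℝ) (el : ℕ → Fin m → Prop)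
    (q : ℕ → Fin m → ℝ) (t : ℕ → ℝ) (z β P V : ℕ → Fin m → ℝ) : Prop where
  one_le_p : 1 ≤ p
  κ_pos : ∀ i, 0 < κ i
  q_nonneg : ∀ k i, 0 ≤ q k i
  P_zero : ∀ i, P 0 i = 0
  V_zero : ∀ i, V 0 i = 0
  P_succ : ∀ k i, P (k + 1) i =
    P k i + (β k i + z k i * powInc p (V k i ^ (1 / p)) (q k i))
  V_succ : ∀ k i, V (k + 1) i = V k i + z k i * powInc p (V k i ^ (1 / p)) (q k i)
  V_nonneg : ∀ k i, 0 ≤ V k i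
  pricing : ∀ k < n, IsPricing κ (P k) (fun i => powInc p (V k i ^ (1 / p)) (q k i)) (el k)
    (t k) (z k) (β k)

namespace FracRun

variable {m : ℕ} {p : ℝ} {n : ℕ} {κ : Fin m → ℝ} {el : ℕ → Fin m → Prop}
  {q : ℕ → Fin m → ℝ} {t : ℕ → ℝ} {z β P V : ℕ → Fin m → ℝ}

lemma inc_nonneg (h : FracRun p n κ el q t z β P V) (k : ℕ) (i : Fin m) :
    0 ≤ powInc p (V k i ^ (1 / p)) (q k i) :=
  powInc_nonneg h.one_le_p (Real.rpow_nonneg (h.V_nonneg k i) _) (h.q_nonneg k i)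

lemma V_eq_sum (h : FracRun p n κ el q t z β P V) (k : ℕ) (i : Fin m) :
    V k i = ∑ j ∈ Finset.range k, z j i * powInc p (V j i ^ (1 / p)) (q j i) := by
  induction k with
  | zero => simp [h.V_zero]
  | succ k ih => rw [Finset.sum_range_succ, ← ih, h.V_succ]

lemma P_eq_add_sum (h : FracRun p n κ el q t z β P V) (k : ℕ) (i : Fin m) :
    P k i = V k i + ∑ j ∈ Finset.range k, β j i := by
  induction k with
  | zero => simp [h.P_zero, h.V_zero]
  | succ k ih => rw [Finset.sum_range_succ, h.P_succ, h.V_succ, ih]; ring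

lemma V_le (h : FracRun p n κ el q t z β P V) {j k : ℕ} (hjk : j ≤ k) (hk : k ≤ n) (i : Fin m) :
    V j i ≤ V k i := by
  induction k, hjk using Nat.le_induction with
  | base => exact le_rfl
  | succ k hjk ih =>
    rw [h.V_succ]
    have := mul_nonneg ((h.pricing k (by omega)).share_nonneg i) (h.inc_nonneg k i)
    linarith [ih (by omega)]

lemma P_le_succ (h : FracRun p n κ el q t z β P V) {k : ℕ} (hk : k < n) (i : Fin m) :
    P k i ≤ P (k + 1) i := by
  rw [h.P_succ]
  have := mul_nonneg ((h.pricing k hk).share_nonneg i) (h.inc_nonneg k i)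
  linarith [(h.pricing k hk).surplus_nonneg i]

lemma P_le (h : FracRun p n κ el q t z β P V) {j k : ℕ} (hjk : j ≤ k) (hk : k ≤ n) (i : Fin m) :
    P j i ≤ P k i := by
  induction k, hjk using Nat.le_induction with
  | base => exact le_rfl
  | succ k hjk ih => exact (ih (by omega)).trans (h.P_le_succ (by omega) i)

/-- At the last job that adds surplus, total payments are still at most `κ i`; they include all
surplus, and later jobs add none. -/
lemma sum_surplus_le (h : FracRun p n κ el q t z β P V) {k : ℕ} (hk : k ≤ n) (i : Fin m) :
    ∑ j ∈ Finset.range k, β j i ≤ κ i := by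
  induction k with
  | zero => simpa using (h.κ_pos i).le
  | succ k ih =>
    have hpr := h.pricing k (by omega)
    rcases (hpr.surplus_nonneg i).eq_or_lt with h0 | h0
    · rw [Finset.sum_range_succ, ← h0, add_zero]; exact ih (by omega)
    · have h1 := hpr.paid_le i h0
      have h2 := h.P_eq_add_sum (k + 1) i
      rw [h.P_succ] at h2
      linarith [h.V_nonneg (k + 1) i]

/-- Until the machine is fully open, its payments, hence `V`, are at most `κ i`. Afterwards the
opening is 1 and every load payment counts in full. -/
lemma V_le_add_sum (h : FracRun p n κ el q t z β P V) {k : ℕ} (hk : k ≤ n) (i : Fin m) :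
    V k i ≤ κ i + ∑ j ∈ Finset.range k, opening m (κ i) (P (j + 1) i) *
      (z j i * powInc p (V j i ^ (1 / p)) (q j i)) := by
  induction k with
  | zero => simpa [h.V_zero] using (h.κ_pos i).le
  | succ k ih =>
    have ih := ih (by omega)
    have hpos : ∀ j ∈ Finset.range (k + 1), 0 ≤ opening m (κ i) (P (j + 1) i) *
        (z j i * powInc p (V j i ^ (1 / p)) (q j i)) := fun j hj => by
      have := (h.pricing j (by have := Finset.mem_range.1 hj; omega)).share_nonneg i
      exact mul_nonneg (opening_nonneg _ _ _) (mul_nonneg this (h.inc_nonneg j i))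
    by_cases h1 : opening m (κ i) (P (k + 1) i) = 1
    · rw [Finset.sum_range_succ, h1, h.V_succ]; linarith
    · have h2 := le_of_opening_ne_one (h.κ_pos i) h1
      rw [h.P_eq_add_sum] at h2
      have h3 : 0 ≤ ∑ j ∈ Finset.range (k + 1), β j i := Finset.sum_nonneg fun j hj =>
        (h.pricing j (by have := Finset.mem_range.1 hj; omega)).surplus_nonneg i
      linarith [Finset.sum_nonneg hpos]

/-- A machine's payment is at most price times share, and at a positive price the opened shares do
not exceed 1. -/
lemma sum_opening_pay_le (h : FracRun p n κ el q t z β P V) {k : ℕ} (hk : k < n) :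
    ∑ i, opening m (κ i) (P (k + 1) i) *
      (β k i + z k i * powInc p (V k i ^ (1 / p)) (q k i)) ≤ t k := by
  have hpr := h.pricing k hk
  refine le_trans ?_ hpr.price_mul_le
  rw [Finset.mul_sum]
  refine Finset.sum_le_sum fun i _ => ?_
  rw [← h.P_succ]
  calc _ ≤ opening m (κ i) (P (k + 1) i) * (t k * z k i) := by
        have := hpr.pay_le i
        have := opening_nonneg m (κ i) (P (k + 1) i)
        gcongr
    _ = _ := by ring

lemma sum_opening_inc_le (h : FracRun p n κ el q t z β P V) :
    ∑ i, ∑ k ∈ Finset.range n, opening m (κ i) (P (k + 1) i) *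
      (z k i * powInc p (V k i ^ (1 / p)) (q k i)) ≤ ∑ k ∈ Finset.range n, t k := by
  rw [Finset.sum_comm]
  refine Finset.sum_le_sum fun k hk => ?_
  have hk' := Finset.mem_range.1 hk
  refine le_trans (Finset.sum_le_sum fun i _ => ?_) (h.sum_opening_pay_le hk')
  have := (h.pricing k hk').surplus_nonneg i
  have := opening_nonneg m (κ i) (P (k + 1) i)
  gcongr
  linarith

/-- The initial openings `1 / m` cost at most 2 together. Each job then raises the fractional cost
by at most `log m` times its price. -/
lemma sum_scaled_cost_le (h : FracRun p n κ el q t z β P V) (hm : 0 < m) (hκ : ∀ i, κ i ≤ 2)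
    {k : ℕ} (hk : k ≤ n) :
    ∑ i, κ i * opening m (κ i) (P k i) ≤ 2 + Real.log m * ∑ j ∈ Finset.range k, t j := by
  have hm' : (0 : ℝ) < m := Nat.cast_pos.2 hm
  induction k with
  | zero =>
    simp only [h.P_zero, opening_zero hm]
    calc ∑ i, κ i * (1 / (m : ℝ)) ≤ ∑ i : Fin m, 2 * (1 / (m : ℝ)) := by
          refine Finset.sum_le_sum fun i _ => ?_
          have := hκ i
          gcongr
      _ = 2 := by simp; field_simp
      _ ≤ _ := by simp
  | succ k ih =>
    have ih := ih (by omega)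
    rw [Finset.sum_range_succ, mul_add]
    have h1 : ∑ i, κ i * (opening m (κ i) (P (k + 1) i) - opening m (κ i) (P k i)) ≤
        Real.log m * t k := by
      refine le_trans (Finset.sum_le_sum fun i _ =>
        opening_sub_le (h.κ_pos i) (h.P_le_succ (by omega) i)) ?_
      rw [← Finset.mul_sum]
      refine mul_le_mul_of_nonneg_left ?_ (Real.log_natCast_nonneg m)
      refine le_trans (le_of_eq ?_) (h.sum_opening_pay_le (show k < n by omega))
      refine Finset.sum_congr rfl fun i _ => ?_
      rw [h.P_succ]; ring
    simp only [mul_sub, Finset.sum_sub_distrib] at h1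
    linarith

/-- Weak duality against the schedule `σ`: each price is charged to surplus and increment at the
machine that `σ` uses. -/
lemma sum_price_le (h : FracRun p n κ el q t z β P V) (σ : ℕ → Fin m)
    (hσ : ∀ k < n, el k (σ k))
    (hcost : ∑ i ∈ (Finset.range n).image σ, κ i ≤ 2)
    (hload : ∑ i, (17 * p * ∑ j ∈ Finset.range n with σ j = i, q j i) ^ p ≤ 1) :
    ∑ k ∈ Finset.range n, t k ≤ 6 := by
  classical
  have hp := h.one_le_p
  have hp0 : 0 < p := by linarith
  set S := (Finset.range n).image σ
  set T := ∑ k ∈ Finset.range n, t k with hT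
  have hmaps : ∀ k ∈ Finset.range n, σ k ∈ S := fun k hk => Finset.mem_image_of_mem σ hk
  have h1 : T ≤ ∑ k ∈ Finset.range n, β k (σ k) +
      2 * ∑ k ∈ Finset.range n, powInc p (V k (σ k) ^ (1 / p)) (q k (σ k)) := by
    rw [Finset.mul_sum, ← Finset.sum_add_distrib]
    refine Finset.sum_le_sum fun k hk => ?_
    have hk' := Finset.mem_range.1 hk
    exact (h.pricing k hk').price_le _ (hσ k hk')
  have h2 : ∑ k ∈ Finset.range n, β k (σ k) ≤ ∑ i ∈ S, κ i := by
    rw [← Finset.sum_fiberwise_of_maps_to hmaps]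
    refine Finset.sum_le_sum fun i _ => ?_
    calc ∑ k ∈ Finset.range n with σ k = i, β k (σ k)
        = ∑ k ∈ Finset.range n with σ k = i, β k i :=
          Finset.sum_congr rfl fun k hk => by rw [(Finset.mem_filter.1 hk).2]
      _ ≤ ∑ k ∈ Finset.range n, β k i :=
          Finset.sum_le_sum_of_subset_of_nonneg (Finset.filter_subset _ _) fun k hk _ =>
            (h.pricing k (Finset.mem_range.1 hk)).surplus_nonneg i
      _ ≤ κ i := h.sum_surplus_le le_rfl i
  have h3 : ∑ k ∈ Finset.range n, powInc p (V k (σ k) ^ (1 / p)) (q k (σ k)) ≤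
      (∑ i ∈ S, V n i) / 8 + 1 := by
    rw [← Finset.sum_fiberwise_of_maps_to hmaps]
    have h4 : ∀ i ∈ S, ∑ k ∈ Finset.range n with σ k = i,
        powInc p (V k (σ k) ^ (1 / p)) (q k (σ k)) ≤
        V n i / 8 + (17 * p * ∑ j ∈ Finset.range n with σ j = i, q j i) ^ p := fun i _ => by
      calc _ = ∑ k ∈ Finset.range n with σ k = i, powInc p (V k i ^ (1 / p)) (q k i) :=
            Finset.sum_congr rfl fun k hk => by rw [(Finset.mem_filter.1 hk).2]
        _ ≤ powInc p (V n i ^ (1 / p)) (∑ k ∈ Finset.range n with σ k = i, q k i) := by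
            refine sum_powInc_le_powInc_sum hp _ _ _
              (fun k _ => Real.rpow_nonneg (h.V_nonneg k i) _) (fun k hk => ?_)
              (fun k _ => h.q_nonneg k i)
            have hk' := Finset.mem_range.1 (Finset.mem_filter.1 hk).1
            exact Real.rpow_le_rpow (h.V_nonneg k i) (h.V_le hk'.le le_rfl i) (by positivity)
        _ ≤ _ := by
            have h5 := powInc_le hp (Real.rpow_nonneg (h.V_nonneg n i) (1 / p))
              (Finset.sum_nonneg fun k (_ : k ∈ (Finset.range n).filter (σ · = i)) =>
                h.q_nonneg k i)
            rwa [← Real.rpow_mul (h.V_nonneg n i), one_div_mul_cancel hp0.ne', Real.rpow_one] at h5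
    refine (Finset.sum_le_sum h4).trans ?_
    rw [Finset.sum_add_distrib, Finset.sum_div]
    gcongr
    refine le_trans (Finset.sum_le_sum_of_subset_of_nonneg (Finset.subset_univ S)
      fun i _ _ => Real.rpow_nonneg (mul_nonneg (by positivity)
        (Finset.sum_nonneg fun k _ => h.q_nonneg k i)) _) hload
  have h6 : ∑ i ∈ S, V n i ≤ 2 + T := by
    calc ∑ i ∈ S, V n i ≤ ∑ i ∈ S, (κ i + ∑ j ∈ Finset.range n,
          opening m (κ i) (P (j + 1) i) * (z j i * powInc p (V j i ^ (1 / p)) (q j i))) :=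
          Finset.sum_le_sum fun i _ => h.V_le_add_sum le_rfl i
      _ ≤ 2 + T := by
          rw [Finset.sum_add_distrib]
          refine add_le_add hcost (le_trans ?_ h.sum_opening_inc_le)
          refine Finset.sum_le_sum_of_subset_of_nonneg (Finset.subset_univ S) fun i _ _ =>
            Finset.sum_nonneg fun j hj => ?_
          exact mul_nonneg (opening_nonneg _ _ _) (mul_nonneg
            ((h.pricing j (Finset.mem_range.1 hj)).share_nonneg i) (h.inc_nonneg j i))
  -- With `T` the total price, the bounds combine to `T ≤ 2 + 2 * ((2 + T) / 8 + 1)`, that is, `T ≤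
  -- 6`.
  linarith

end FracRun

/-! ### Potential argument for the greedy assignment -/

/-- Greedy assignment among open machines: if each job increases the sum of the `p`-th powers of
the loads by at most twice the average increase with respect to the shares, then this sum is
controlled by the load payments at the open machines. -/
lemma greedy_sum_le {m : ℕ} {p : ℝ} (hp : 1 ≤ p) (n : ℕ) (q z V M : ℕ → Fin m → ℝ)
    (hq : ∀ k i, 0 ≤ q k i) (hz0 : ∀ k < n, ∀ i, 0 ≤ z k i) (hz1 : ∀ k < n, ∀ i, z k i ≤ 1)
    (hV : ∀ k < n, ∀ i, ∑ j ∈ Finset.range k, z j i * powInc p (V j i ^ (1 / p)) (q j i) ≤ V k i)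
    (hV0 : ∀ k < n, ∀ i, 0 ≤ V k i) (hM0 : ∀ i, M 0 i = 0)
    (hM : ∀ k < n, ∀ i, M k i ≤ M (k + 1) i)
    (hstep : ∀ k < n, ∑ i, M (k + 1) i ^ p ≤
      ∑ i, M k i ^ p + 2 * ∑ i, z k i * powInc p (M k i) (q k i)) :
    ∑ i, M n i ^ p ≤
      3 * (17 * p) ^ p * ∑ i, ∑ j ∈ Finset.range n, z j i * powInc p (V j i ^ (1 / p)) (q j i) := by
  have hp0 : 0 < p := by linarith
  have hMle : ∀ j k, j ≤ k → k ≤ n → ∀ i, M j i ≤ M k i := by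
    intro j k hjk
    induction k, hjk using Nat.le_induction with
    | base => intro _ i; exact le_rfl
    | succ k _ ih => intro hk i; exact (ih (by omega) i).trans (hM k (by omega) i)
  have hMn : ∀ k ≤ n, ∀ i, 0 ≤ M k i := fun k hk i => by
    have := hMle 0 k (by omega) hk i
    rwa [hM0] at this
  have h1 : ∀ k ≤ n, ∑ i, M k i ^ p ≤
      2 * ∑ j ∈ Finset.range k, ∑ i, z j i * powInc p (M j i) (q j i) := by
    intro k
    induction k with
    | zero => intro _; simp [hM0, Real.zero_rpow hp0.ne']
    | succ k ih =>
      intro hk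
      rw [Finset.sum_range_succ]
      linarith [ih (by omega), hstep k (by omega)]
  -- All increments are moved to the final load `M n i`; `sum_powInc_le` then merges them into the
  -- single increment by `T ^ (1 / p)`, to which `powInc_le` applies.
  have h2 : ∑ j ∈ Finset.range n, ∑ i, z j i * powInc p (M j i) (q j i) ≤
      ∑ i, (M n i ^ p / 8 + (17 * p) ^ p *
        ∑ j ∈ Finset.range n, z j i * powInc p (V j i ^ (1 / p)) (q j i)) := by
    rw [Finset.sum_comm]
    refine Finset.sum_le_sum fun i _ => ?_
    set T := ∑ j ∈ Finset.range n, z j i * powInc p (V j i ^ (1 / p)) (q j i)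
    have hT : 0 ≤ T := Finset.sum_nonneg fun j hj => by
      have hj' := Finset.mem_range.1 hj
      exact mul_nonneg (hz0 j hj' i)
        (powInc_nonneg hp (Real.rpow_nonneg (hV0 j hj' i) _) (hq j i))
    have hMi := hMn n le_rfl i
    have h3 : ∑ j ∈ Finset.range n, z j i * powInc p (M j i) (q j i) ≤
        ∑ j ∈ Finset.range n, z j i * powInc p (M n i) (q j i) := by
      refine Finset.sum_le_sum fun j hj => ?_
      have hj' := Finset.mem_range.1 hj
      exact mul_le_mul_of_nonneg_left (powInc_mono hp (hMn j hj'.le i)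
        (hMle j n hj'.le le_rfl i) (hq j i)) (hz0 j hj' i)
    have h4 : M n i ^ p + ∑ j ∈ Finset.range n, z j i * powInc p (M n i) (q j i) ≤
        (M n i + T ^ (1 / p)) ^ p :=
      sum_powInc_le hp hMi n (fun j => z j i) (fun j => q j i) (fun j => V j i)
        (fun k hk => hz0 k hk i) (fun k hk => hz1 k hk i) (fun k _ => hq k i)
        (fun k hk => hV k hk i) (fun k hk => hV0 k hk i)
    have h5 := powInc_le (l := T ^ (1 / p)) hp hMi (by positivity)
    rw [Real.mul_rpow (by positivity) (by positivity), ← Real.rpow_mul hT,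
      one_div_mul_cancel hp0.ne', Real.rpow_one] at h5
    unfold powInc at h5
    linarith
  have h6 := h1 n le_rfl
  rw [Finset.sum_add_distrib, ← Finset.sum_div, ← Finset.mul_sum] at h2
  have h7 : 0 ≤ (17 * p) ^ p *
      ∑ i, ∑ j ∈ Finset.range n, z j i * powInc p (V j i ^ (1 / p)) (q j i) := by
    refine mul_nonneg (by positivity) (Finset.sum_nonneg fun i _ => Finset.sum_nonneg fun j hj => ?_)
    have hj' := Finset.mem_range.1 hj
    exact mul_nonneg (hz0 j hj' i)
      (powInc_nonneg hp (Real.rpow_nonneg (hV0 j hj' i) _) (hq j i))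
  -- An eighth, doubled, is a quarter of the left side; absorbing it leaves the factor `8 / 3 ≤ 3`.
  linarith

/-! ### Random thresholds and the Chernoff bound -/

lemma measurableSet_coe_le (r : ℝ) : MeasurableSet {u : unitInterval | (u : ℝ) ≤ r} :=
  measurableSet_le measurable_subtype_coe measurable_const

lemma volume_coe_le {r : ℝ} (hr : 0 ≤ r) :
    volume {u : unitInterval | (u : ℝ) ≤ r} = ENNReal.ofReal (min 1 r) := by
  have : {u : unitInterval | (u : ℝ) ≤ r} =
      Set.Iic (⟨min 1 r, le_min zero_le_one hr, min_le_left _ _⟩ : unitInterval) := by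
    ext u
    simp only [Set.mem_ofPred_eq, Set.mem_Iic, ← Subtype.coe_le_coe, le_min_iff]
    exact ⟨fun h => ⟨u.2.2, h⟩, fun h => h.2⟩
  rw [this, unitInterval.volume_Iic]

lemma measurableSet_apply_le {m : ℕ} (i : Fin m) (r : ℝ) :
    MeasurableSet {θ : Fin m → unitInterval | (θ i : ℝ) ≤ r} :=
  measurableSet_le (measurable_subtype_coe.comp (measurable_pi_apply i)) measurable_const

lemma volume_apply_le {m : ℕ} (i : Fin m) {r : ℝ} (hr : 0 ≤ r) :
    volume {θ : Fin m → unitInterval | (θ i : ℝ) ≤ r} ≤ ENNReal.ofReal r := by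
  have h := (measurePreserving_eval (fun _ : Fin m => (volume : Measure unitInterval)) i).measure_preimage
    (measurableSet_coe_le r).nullMeasurableSet
  have h' : volume {θ : Fin m → unitInterval | (θ i : ℝ) ≤ r} =
    volume {u : unitInterval | (u : ℝ) ≤ r} := h
  rw [h', volume_coe_le hr]
  exact ENNReal.ofReal_le_ofReal (min_le_right _ _)

open Classical in
lemma integral_ite_coe_le {r c : ℝ} (hr : 0 ≤ r) :
    ∫ u : unitInterval, (if (u : ℝ) ≤ r then c else 1) = 1 - min 1 r * (1 - c) := by
  have h : (fun u : unitInterval => if (u : ℝ) ≤ r then c else 1) =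
      fun u => 1 - ({u : unitInterval | (u : ℝ) ≤ r}.indicator (fun _ => 1 - c) u) := by
    funext u
    by_cases hu : (u : ℝ) ≤ r <;> simp [hu]
  rw [h, integral_sub (integrable_const _)
    ((integrable_const _).indicator (measurableSet_coe_le r)),
    integral_indicator_const _ (measurableSet_coe_le r), measureReal_def, volume_coe_le hr,
    ENNReal.toReal_ofReal (le_min zero_le_one hr)]
  simp

lemma one_sub_exp_neg_mul_ge {s z : ℝ} (hz0 : 0 ≤ z) (hz1 : z ≤ 1) :
    z * (1 - Real.exp (-s)) ≤ 1 - Real.exp (-(s * z)) := by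
  have h := convexOn_exp.2 (Set.mem_univ (-s)) (Set.mem_univ 0) hz0 (sub_nonneg.2 hz1) (by ring)
  simp only [smul_eq_mul, mul_zero, add_zero, Real.exp_zero, mul_one] at h
  rw [show -(s * z) = z * -s by ring]
  linarith

/-- The left side is the Laplace transform at `s` of a share `z` that is present with probability
`min 1 (2 * s * x)`. Below saturation, `1 - exp (-(s * z)) ≥ z / 2` by convexity, and the 2 in the
probability compensates for this half. -/
lemma one_sub_min_mul_le {s x z : ℝ} (hs : 1 ≤ s) (hx0 : 0 ≤ x) (hx1 : x ≤ 1) (hz0 : 0 ≤ z)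
    (hz1 : z ≤ 1) :
    1 - min 1 (2 * s * x) * (1 - Real.exp (-(s * z))) ≤ Real.exp (-(s * (x * z))) := by
  rcases le_total 1 (2 * s * x) with h | h
  · rw [min_eq_left h]
    have : s * (x * z) ≤ s * z := by nlinarith [mul_nonneg (by linarith : 0 ≤ s) hz0]
    have := Real.exp_le_exp.2 (neg_le_neg this)
    linarith
  · rw [min_eq_right h]
    have h1 := one_sub_exp_neg_mul_ge (s := s) hz0 hz1
    have h2 : Real.exp (-s) ≤ 1 / 2 := by
      have h3 := Real.add_one_le_exp s
      have h4 : Real.exp (-s) * Real.exp s = 1 := by rw [← Real.exp_add]; simp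
      have h5 := Real.exp_pos (-s)
      nlinarith
    have h6 : z / 2 ≤ 1 - Real.exp (-(s * z)) := by nlinarith
    have h7 : 0 ≤ 2 * s * x := by positivity
    have h8 := mul_le_mul_of_nonneg_left h6 h7
    have h9 := Real.add_one_le_exp (-(s * (x * z)))
    linarith

open Classical in
/-- The total share of the open machines is rarely below one half. -/
lemma volume_openShare_lt_le {m : ℕ} {α : ℝ} (hα : 2 ≤ α) {x z : Fin m → ℝ}
    (hx0 : ∀ i, 0 ≤ x i) (hx1 : ∀ i, x i ≤ 1) (hz0 : ∀ i, 0 ≤ z i) (hz1 : ∀ i, z i ≤ 1)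
    (hxz : 1 ≤ ∑ i, x i * z i) :
    volume {θ : Fin m → unitInterval |
      ∑ i, (if (θ i : ℝ) ≤ α * x i then z i else 0) < 1 / 2} ≤
      ENNReal.ofReal (Real.exp (-(α / 4))) := by
  -- Tilting by `s = α / 2` gives Laplace transform at most `exp (-s)` by independence of the
  -- thresholds; Markov at the level `exp (-(s / 2))` leaves `exp (-(α / 4))`.
  set s := α / 2 with hs
  have hs1 : 1 ≤ s := by linarith
  have hαs : α = 2 * s := by linarith
  set g : Fin m → unitInterval → ℝ :=
    fun i u => if (u : ℝ) ≤ α * x i then Real.exp (-(s * z i)) else 1 with hg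
  have hgm : ∀ i, Measurable (g i) := fun i =>
    Measurable.ite (measurableSet_coe_le _) measurable_const measurable_const
  have hg0 : ∀ i u, 0 ≤ g i u := fun i u => by
    simp only [hg]; split_ifs
    · exact (Real.exp_pos _).le
    · exact zero_le_one
  have hg1 : ∀ i u, g i u ≤ 1 := fun i u => by
    simp only [hg]; split_ifs
    · exact Real.exp_le_one_iff.2 (by have := mul_nonneg (by linarith : 0 ≤ s) (hz0 i); linarith)
    · exact le_rfl
  set G : (Fin m → unitInterval) → ℝ := fun θ => ∏ i, g i (θ i) with hG
  have hGm : Measurable G := Finset.measurable_prod _ fun i _ => (hgm i).comp (measurable_pi_apply i)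
  have hG0 : ∀ θ, 0 ≤ G θ := fun θ => Finset.prod_nonneg fun i _ => hg0 i _
  have hG1 : ∀ θ, G θ ≤ 1 := fun θ => Finset.prod_le_one (fun i _ => hg0 i _) fun i _ => hg1 i _
  have hGi : Integrable G volume := Integrable.of_bound hGm.aestronglyMeasurable 1
    (Filter.Eventually.of_forall fun θ => by rw [Real.norm_of_nonneg (hG0 θ)]; exact hG1 θ)
  have hint : ∫ θ, G θ ≤ Real.exp (-s) := by
    rw [hG, integral_fintype_prod_volume_eq_prod]
    calc ∏ i, ∫ u, g i u ≤ ∏ i, Real.exp (-(s * (x i * z i))) := by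
          refine Finset.prod_le_prod (fun i _ => integral_nonneg (hg0 i)) fun i _ => ?_
          have hr : 0 ≤ α * x i := mul_nonneg (by linarith) (hx0 i)
          simp only [hg]
          rw [integral_ite_coe_le hr, hαs]
          exact one_sub_min_mul_le hs1 (hx0 i) (hx1 i) (hz0 i) (hz1 i)
      _ = Real.exp (-(s * ∑ i, x i * z i)) := by
          rw [← Real.exp_sum, Finset.sum_neg_distrib, Finset.mul_sum]
      _ ≤ Real.exp (-s) := Real.exp_le_exp.2 (by nlinarith)
  have hGlow : ∀ θ, ∑ i, (if (θ i : ℝ) ≤ α * x i then z i else 0) < 1 / 2 →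
      Real.exp (-(s / 2)) ≤ G θ := fun θ hθ => by
    have : G θ = Real.exp (-(s * ∑ i, (if (θ i : ℝ) ≤ α * x i then z i else 0))) := by
      rw [Finset.mul_sum, ← Finset.sum_neg_distrib, Real.exp_sum]
      refine Finset.prod_congr rfl fun i _ => ?_
      simp only [hg]; split_ifs <;> simp
    rw [this]
    exact Real.exp_le_exp.2 (by nlinarith)
  have hM := mul_meas_ge_le_integral_of_nonneg (Filter.Eventually.of_forall hG0) hGi
    (Real.exp (-(s / 2)))
  have h1 : (volume : Measure (Fin m → unitInterval)).real {θ | Real.exp (-(s / 2)) ≤ G θ} ≤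
      Real.exp (-(α / 4)) := by
    have h2 : Real.exp (-s) = Real.exp (-(s / 2)) * Real.exp (-(α / 4)) := by
      rw [← Real.exp_add, hαs]; ring_nf
    have h3 := hM.trans hint
    rw [h2] at h3
    exact le_of_mul_le_mul_left h3 (Real.exp_pos _)
  refine (measure_mono (t := {θ | Real.exp (-(s / 2)) ≤ G θ}) (fun θ hθ => hGlow θ hθ)).trans ?_
  rw [← ENNReal.ofReal_toReal (measure_ne_top volume {θ | Real.exp (-(s / 2)) ≤ G θ})]
  exact ENNReal.ofReal_le_ofReal h1

/-! ### The algorithm and its dependence on past jobs only -/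

open Classical in
/-- Some element satisfying `P`, or else some element satisfying `Q`, or else any element. -/
noncomputable def preferred {ι : Type*} [Nonempty ι] (P Q : ι → Prop) : ι :=
  if h : ∃ i, P i then h.choose else if h : ∃ i, Q i then h.choose else Classical.arbitrary _

lemma preferred_spec {ι : Type*} [Nonempty ι] {P : ι → Prop} (Q : ι → Prop) (h : ∃ i, P i) :
    P (preferred P Q) := by
  unfold preferred
  rw [dif_pos h]
  exact h.choose_spec

/-- Makes every chosen machine eligible, whether the greedy rule or the fallback selects it. -/
lemma preferred_spec_of_imp {ι : Type*} [Nonempty ι] {P Q : ι → Prop} (hPQ : ∀ i, P i → Q i)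
    (h : ∃ i, Q i) : Q (preferred P Q) := by
  by_cases hP : ∃ i, P i
  · exact hPQ _ (preferred_spec Q hP)
  · unfold preferred
    rw [dif_neg hP, dif_pos h]
    exact h.choose_spec

/-- What the algorithm knows in advance: the exponent, the startup costs and the promise. -/
structure Params (m : ℕ) where
  /-- the exponent of the norm -/
  p : ℝ
  /-- the startup costs -/
  c : Fin m → ℝ≥0
  /-- the promised cost -/
  C : ℝ≥0
  /-- the promised norm -/
  L : ℝ≥0

namespace Params

variable {m : ℕ} (I : Params m)

/-- The startup costs relative to the promised cost, bounded away from zero. -/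
noncomputable def scaledCost (i : Fin m) : ℝ := min ((I.c i : ℝ) / I.C) 1 + 1 / m

/-- The machines that a schedule within the promise may use for a job. -/
def Eligible (job : Job m) (i : Fin m) : Prop := I.c i ≤ I.C ∧ job i ≤ I.L

/-- The processing time relative to the promised norm, scaled down by `17 * p`. -/
noncomputable def size (job : Job m) (i : Fin m) : ℝ := (job i / I.L).toReal / (17 * I.p)

/-- The increments of the `p`-th powers caused by a job, given the load payments `V`. -/
noncomputable def increment (V : Fin m → ℝ) (job : Job m) (i : Fin m) : ℝ :=
  powInc I.p (V i ^ (1 / I.p)) (I.size job i)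

open Classical in
/-- A price, shares and surpluses for a job, given the payments `s.1` and load payments `s.2`. -/
noncomputable def pricing (s : (Fin m → ℝ) × (Fin m → ℝ)) (job : Job m) :
    ℝ × (Fin m → ℝ) × (Fin m → ℝ) :=
  if h : ∃ w : ℝ × (Fin m → ℝ) × (Fin m → ℝ), IsPricing I.scaledCost s.1 (I.increment s.2 job)
    (I.Eligible job) w.1 w.2.1 w.2.2 then h.choose else 0

/-- The payments and the load payments before job `k` arrives. -/
noncomputable def state (jobs : ℕ → Job m) : ℕ → (Fin m → ℝ) × (Fin m → ℝ)
  | 0 => 0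
  | k + 1 =>
    let s := state jobs k
    let w := I.pricing s (jobs k)
    (fun i => s.1 i + (w.2.2 i + w.2.1 i * I.increment s.2 (jobs k) i),
      fun i => s.2 i + w.2.1 i * I.increment s.2 (jobs k) i)

/-- The price of job `k`. -/
noncomputable def price (jobs : ℕ → Job m) (k : ℕ) : ℝ := (I.pricing (I.state jobs k) (jobs k)).1

/-- The shares of job `k`. -/
noncomputable def shares (jobs : ℕ → Job m) (k : ℕ) : Fin m → ℝ :=
  (I.pricing (I.state jobs k) (jobs k)).2.1

/-- The surpluses of job `k`. -/
noncomputable def surplus (jobs : ℕ → Job m) (k : ℕ) : Fin m → ℝ :=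
  (I.pricing (I.state jobs k) (jobs k)).2.2

/-- A machine is open at job `k` if its random threshold is at most this number. -/
noncomputable def level (jobs : ℕ → Job m) (k : ℕ) (i : Fin m) : ℝ :=
  8 * Real.log (m * (k + 1)) * opening m (I.scaledCost i) ((I.state jobs (k + 1)).1 i)

open Classical in
/-- The shares of job `k`, restricted to the open machines. -/
noncomputable def openShares (jobs : ℕ → Job m) (O : ℕ → Fin m → Prop) (k : ℕ) (i : Fin m) : ℝ :=
  if O k i then I.shares jobs k i else 0

/-- The open machines take at least one half of job `k`. -/
def Covered (jobs : ℕ → Job m) (O : ℕ → Fin m → Prop) (k : ℕ) : Prop :=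
  1 / 2 ≤ ∑ i, I.openShares jobs O k i

/-- Machine `i` has minimal increment among the open machines with a positive share of job `k`. -/
def IsGreedy (jobs : ℕ → Job m) (O : ℕ → Fin m → Prop) (M : Fin m → ℝ) (k : ℕ) (i : Fin m) :
    Prop :=
  0 < I.openShares jobs O k i ∧ ∀ j, 0 < I.openShares jobs O k j →
    powInc I.p (M i) (I.size (jobs k) i) ≤ powInc I.p (M j) (I.size (jobs k) j)

/-- The machine for job `k`, given the current loads `M`: a greedy one if the job is covered, and
any eligible one otherwise. -/
noncomputable def pick [Nonempty (Fin m)] (jobs : ℕ → Job m) (O : ℕ → Fin m → Prop)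
    (M : Fin m → ℝ) (k : ℕ) : Fin m :=
  preferred (fun i => I.Covered jobs O k ∧ I.IsGreedy jobs O M k i) (I.Eligible (jobs k))

open Classical in
/-- The scaled loads caused by the covered jobs before job `k`. -/
noncomputable def mainLoad [Nonempty (Fin m)] (jobs : ℕ → Job m) (O : ℕ → Fin m → Prop) :
    ℕ → Fin m → ℝ
  | 0 => 0
  | k + 1 => fun i => mainLoad jobs O k i +
      if I.Covered jobs O k ∧ I.pick jobs O (mainLoad jobs O k) k = i then I.size (jobs k) i else 0

/-- The machine to which job `k` is assigned. -/
noncomputable def machine [Nonempty (Fin m)] (jobs : ℕ → Job m) (O : ℕ → Fin m → Prop) (k : ℕ) :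
    Fin m :=
  I.pick jobs O (I.mainLoad jobs O k) k

lemma state_congr {jobs jobs' : ℕ → Job m} {k : ℕ} (h : ∀ t < k, jobs t = jobs' t) :
    I.state jobs k = I.state jobs' k := by
  induction k with
  | zero => rfl
  | succ k ih => simp only [state, ih fun t ht => h t (by omega), h k (by omega)]

lemma shares_congr {jobs jobs' : ℕ → Job m} {k : ℕ} (h : ∀ t ≤ k, jobs t = jobs' t) :
    I.shares jobs k = I.shares jobs' k := by
  simp only [shares, I.state_congr fun t ht => h t ht.le, h k le_rfl]

lemma level_congr {jobs jobs' : ℕ → Job m} {k : ℕ} (h : ∀ t ≤ k, jobs t = jobs' t) :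
    I.level jobs k = I.level jobs' k := by
  funext i
  simp only [level, I.state_congr (k := k + 1) fun t ht => h t (by omega)]

lemma openShares_congr {jobs jobs' : ℕ → Job m} {O O' : ℕ → Fin m → Prop} {k : ℕ}
    (h : ∀ t ≤ k, jobs t = jobs' t) (hO : O k = O' k) :
    I.openShares jobs O k = I.openShares jobs' O' k := by
  funext i
  unfold openShares
  rw [I.shares_congr h, hO]

lemma pick_congr [Nonempty (Fin m)] {jobs jobs' : ℕ → Job m} {O O' : ℕ → Fin m → Prop} {k : ℕ}
    (h : ∀ t ≤ k, jobs t = jobs' t) (hO : O k = O' k) (M : Fin m → ℝ) :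
    I.pick jobs O M k = I.pick jobs' O' M k := by
  unfold pick Covered IsGreedy
  rw [I.openShares_congr h hO, h k le_rfl]

lemma mainLoad_congr [Nonempty (Fin m)] {jobs jobs' : ℕ → Job m} {O O' : ℕ → Fin m → Prop}
    {k : ℕ} (h : ∀ t < k, jobs t = jobs' t) (hO : ∀ t < k, O t = O' t) :
    I.mainLoad jobs O k = I.mainLoad jobs' O' k := by
  induction k with
  | zero => rfl
  | succ k ih =>
    have h' : ∀ t ≤ k, jobs t = jobs' t := fun t ht => h t (by omega)
    unfold mainLoad Covered
    rw [ih (fun t ht => h t (by omega)) fun t ht => hO t (by omega),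
      I.pick_congr h' (hO k (by omega)), I.openShares_congr h' (hO k (by omega)), h k (by omega)]

lemma machine_congr [Nonempty (Fin m)] {jobs jobs' : ℕ → Job m} {O O' : ℕ → Fin m → Prop}
    {k : ℕ} (h : ∀ t ≤ k, jobs t = jobs' t) (hO : ∀ t ≤ k, O t = O' t) :
    I.machine jobs O k = I.machine jobs' O' k := by
  simp only [machine, I.pick_congr h (hO k le_rfl),
    I.mainLoad_congr (fun t ht => h t ht.le) fun t ht => hO t ht.le]

end Params

/-! ### Realization as an online algorithm -/

/-- A finite job sequence, continued by jobs of size zero. -/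
def extend {m n : ℕ} (jobs : Fin n → Job m) (t : ℕ) : Job m :=
  if h : t < n then jobs ⟨t, h⟩ else 0

lemma extend_apply {m n : ℕ} (jobs : Fin n → Job m) (j : Fin n) : extend jobs j = jobs j := by
  simp [extend]

/-- The pattern of open machines given by the thresholds. -/
def Params.pattern {m : ℕ} (I : Params m) (jobs : ℕ → Job m) (θ : Fin m → unitInterval) (t : ℕ)
    (i : Fin m) : Prop :=
  (θ i : ℝ) ≤ I.level jobs t i

/-- The choice depends on the thresholds only through the open patterns at times up to `k`, which
lie in a finite discrete space. -/
lemma Params.measurable_machine {m : ℕ} [Nonempty (Fin m)] (I : Params m) (jobs : ℕ → Job m)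
    (k : ℕ) : Measurable fun θ => I.machine jobs (I.pattern jobs θ) k := by
  have h : (fun θ => I.machine jobs (I.pattern jobs θ) k) =
      (fun O : Fin (k + 1) → Fin m → Prop =>
        I.machine jobs (fun t i => ∃ h : t < k + 1, O ⟨t, h⟩ i) k) ∘
      fun θ t => I.pattern jobs θ t := by
    funext θ
    refine I.machine_congr (fun _ _ => rfl) fun t ht => ?_
    funext i
    simp [Nat.lt_succ_of_le ht]
  rw [h]
  refine Measurable.of_discrete.comp ?_
  refine measurable_pi_lambda _ fun t => measurable_pi_lambda _ fun i => ?_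
  exact measurableSet_setOfPred.1 (measurableSet_apply_le i _)

/-- The algorithm: a random threshold for every machine, and greedy assignment to the machines
whose thresholds are exceeded by the fractional solution. -/
noncomputable def Params.algorithm {m : ℕ} [Nonempty (Fin m)] (I : Params m) :
    RandomizedOnlineAlgorithm m where
  Ω := Fin m → unitInterval
  measurableSpace := inferInstance
  μ := volume
  isProbabilityMeasure := inferInstance
  assign k seen θ := I.machine (extend seen) (I.pattern (extend seen) θ) k
  measurable_assign k seen := I.measurable_machine (extend seen) k

/-- Zero-padding after the current job does not affect the decision, so the separate online
decisions form one run on the whole sequence. -/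
lemma Params.schedule_algorithm {m n : ℕ} [Nonempty (Fin m)] (I : Params m)
    (jobs : Fin n → Job m) (θ : Fin m → unitInterval) (j : Fin n) :
    I.algorithm.schedule jobs θ j =
      I.machine (extend jobs) (I.pattern (extend jobs) θ) j := by
  have h : ∀ t ≤ (j : ℕ), extend (fun i : Fin (j + 1) =>
      jobs ⟨i, lt_of_lt_of_le i.isLt j.isLt⟩) t = extend jobs t := fun t ht => by
    have h1 : t < j + 1 := by omega
    have h2 : t < n := by omega
    simp [extend, h1, h2]
  refine I.machine_congr h fun t ht => ?_
  funext i
  simp only [Params.pattern, I.level_congr fun u hu => h u (hu.trans ht)]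

/-! ### Consequences of the promise -/

lemma sum_rpow_le_rpow_sum {ι : Type*} (s : Finset ι) (b : ι → ℝ≥0∞) {p : ℝ} (hp : 1 ≤ p) :
    ∑ i ∈ s, b i ^ p ≤ (∑ i ∈ s, b i) ^ p := by
  classical
  induction s using Finset.induction_on with
  | empty => simp
  | insert a s ha ih =>
    rw [Finset.sum_insert ha, Finset.sum_insert ha]
    exact (add_le_add_right ih _).trans (ENNReal.add_rpow_le_rpow_add _ _ hp)

lemma rpow_sum_rpow_le_sum {ι : Type*} (s : Finset ι) (b : ι → ℝ≥0∞) {p : ℝ} (hp : 1 ≤ p) :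
    (∑ i ∈ s, b i ^ p) ^ (1 / p) ≤ ∑ i ∈ s, b i := by
  have hp0 : 0 < p := by linarith
  calc (∑ i ∈ s, b i ^ p) ^ (1 / p) ≤ ((∑ i ∈ s, b i) ^ p) ^ (1 / p) :=
        ENNReal.rpow_le_rpow (sum_rpow_le_rpow_sum s b hp) (by positivity)
    _ = ∑ i ∈ s, b i := by
        rw [← ENNReal.rpow_mul, mul_one_div_cancel hp0.ne', ENNReal.rpow_one]

lemma extend_load {m n : ℕ} (jobs : Fin n → Job m) (τ : ℕ → Fin m) (i : Fin m) :
    load jobs (fun j => τ j) i = ∑ k ∈ Finset.range n with τ k = i, extend jobs k i := by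
  unfold load
  rw [Finset.sum_filter, Finset.sum_filter,
    ← Fin.sum_univ_eq_sum_range (fun k => if τ k = i then extend jobs k i else 0) n]
  refine Finset.sum_congr rfl fun j _ => ?_
  rw [extend_apply]

lemma openMachines_eq_image {m n : ℕ} (τ : ℕ → Fin m) :
    openMachines (fun j : Fin n => τ j) = (Finset.range n).image τ := by
  ext i
  simp only [openMachines, Finset.mem_image, Finset.mem_univ, true_and, Finset.mem_range]
  exact ⟨fun ⟨j, hj⟩ => ⟨j, j.2, hj⟩, fun ⟨k, hk, hj⟩ => ⟨⟨k, hk⟩, hj⟩⟩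

lemma Promise.exists_nat {m n : ℕ} [Nonempty (Fin m)] {c : Fin m → ℝ≥0} {p : ℝ} {C L : ℝ≥0}
    {jobs : Fin n → Job m} (h : Promise c p C L jobs) :
    ∃ τ : ℕ → Fin m, cost c (fun j : Fin n => τ j) ≤ C ∧
      loadNorm p jobs (fun j => τ j) ≤ L := by
  obtain ⟨σ, h1, h2⟩ := h
  refine ⟨fun k => if h : k < n then σ ⟨k, h⟩ else Classical.arbitrary _, ?_⟩
  have : (fun j : Fin n => if h : (j : ℕ) < n then σ ⟨j, h⟩ else Classical.arbitrary _) = σ := by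
    funext j; simp
  rw [this]
  exact ⟨h1, h2⟩

lemma sum_load_rpow_le {m n : ℕ} {p : ℝ} (hp : 1 ≤ p) {jobs : Fin n → Job m} {σ : Schedule n m}
    {L : ℝ≥0} (h : loadNorm p jobs σ ≤ L) : ∑ i, load jobs σ i ^ p ≤ (L : ℝ≥0∞) ^ p := by
  have hp0 : 0 < p := by linarith
  have := ENNReal.rpow_le_rpow h hp0.le
  rwa [loadNorm, ← ENNReal.rpow_mul, one_div_mul_cancel hp0.ne', ENNReal.rpow_one] at this

lemma load_le {m n : ℕ} {p : ℝ} (hp : 1 ≤ p) {jobs : Fin n → Job m} {σ : Schedule n m}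
    {L : ℝ≥0} (h : loadNorm p jobs σ ≤ L) (i : Fin m) : load jobs σ i ≤ L := by
  have hp0 : 0 < p := by linarith
  exact (ENNReal.rpow_le_rpow_iff hp0).1 ((Finset.single_le_sum
    (f := fun i => load jobs σ i ^ p) (fun _ _ => zero_le) (Finset.mem_univ i)).trans
    (sum_load_rpow_le hp h))

namespace Params

variable {m : ℕ} (I : Params m)

lemma scaledCost_pos (hm : 0 < m) (i : Fin m) : 0 < I.scaledCost i := by
  have : (0 : ℝ) < m := Nat.cast_pos.2 hm
  unfold scaledCost
  positivity

lemma scaledCost_le_two (hm : 0 < m) (i : Fin m) : I.scaledCost i ≤ 2 := by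
  have h1 : (1 : ℝ) / m ≤ 1 := by
    rw [one_div]
    exact inv_le_one_of_one_le₀ (Nat.one_le_cast.2 hm)
  have h2 : min ((I.c i : ℝ) / I.C) 1 ≤ 1 := min_le_right _ _
  unfold scaledCost
  linarith

lemma cost_le_scaledCost {i : Fin m} (h : I.c i ≤ I.C) :
    (I.c i : ℝ) ≤ I.C * I.scaledCost i := by
  have hC : (0 : ℝ) ≤ I.C := I.C.2
  have h' : (I.c i : ℝ) ≤ I.C := h
  have h0 : (0 : ℝ) ≤ I.c i := (I.c i).2
  have h1 : (I.c i : ℝ) ≤ I.C * min ((I.c i : ℝ) / I.C) 1 := by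
    rcases hC.eq_or_lt with h2 | h2
    · rw [← h2] at h' ⊢; simpa using h'
    · rw [min_eq_left ((div_le_one h2).2 h'), mul_div_cancel₀ _ h2.ne']
  have h3 : 0 ≤ (I.C : ℝ) * (1 / m) := by positivity
  unfold scaledCost
  linarith

lemma size_nonneg (hp : 1 ≤ I.p) (job : Job m) (i : Fin m) : 0 ≤ I.size job i :=
  div_nonneg ENNReal.toReal_nonneg (by linarith)

lemma eq_ofReal_size (hp : 1 ≤ I.p) {job : Job m} {i : Fin m} (h : job i ≤ I.L) :
    job i = ENNReal.ofReal (17 * I.p * I.L * I.size job i) := by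
  have hp0 : 17 * I.p ≠ 0 := by linarith
  have h1 : 17 * I.p * I.L * I.size job i = (I.L * (job i / I.L)).toReal := by
    rw [ENNReal.toReal_mul, ENNReal.coe_toReal, size]
    field_simp
  have h2 : (I.L : ℝ≥0∞) * (job i / I.L) = job i := by
    -- For `L = 0`, eligibility forces processing time 0, so the convention for division by zero is
    -- harmless.
    rcases eq_or_ne I.L 0 with h3 | h3
    · rw [h3] at h ⊢
      have : job i = 0 := by simpa using h
      simp [this]
    · exact ENNReal.mul_div_cancel (by simpa using h3) ENNReal.coe_ne_top
  rw [h1, h2, ENNReal.ofReal_toReal (ne_top_of_le_ne_top ENNReal.coe_ne_top h)]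

/-- One unit comes from the promised cost and one from the additive terms `1 / m`. -/
lemma promise_scaledCost {n : ℕ} (hm : 0 < m) {τ : ℕ → Fin m}
    (h : cost I.c (fun j : Fin n => τ j) ≤ I.C) :
    ∑ i ∈ (Finset.range n).image τ, I.scaledCost i ≤ 2 := by
  have hm' : (0 : ℝ) < m := Nat.cast_pos.2 hm
  have hC : (0 : ℝ) ≤ I.C := I.C.2
  set S := (Finset.range n).image τ with hS
  have h' : ∑ i ∈ S, (I.c i : ℝ) ≤ I.C := by
    unfold cost at h
    rw [openMachines_eq_image] at h
    exact_mod_cast h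
  have h1 : ∑ i ∈ S, min ((I.c i : ℝ) / I.C) 1 ≤ 1 := by
    refine (Finset.sum_le_sum fun i _ => min_le_left _ _).trans ?_
    rw [← Finset.sum_div]
    exact div_le_one_of_le₀ h' hC
  have h2 : ∑ i ∈ S, (1 : ℝ) / m ≤ 1 := by
    have : (S.card : ℝ) ≤ m := by
      have := Finset.card_le_univ S
      rw [Fintype.card_fin] at this
      exact_mod_cast this
    rw [Finset.sum_const, nsmul_eq_mul, mul_one_div]
    exact (div_le_one hm').2 this
  unfold scaledCost
  rw [Finset.sum_add_distrib]
  linarith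

lemma promise_eligible {n : ℕ} (hp : 1 ≤ I.p) {jobs : Fin n → Job m} {τ : ℕ → Fin m}
    (hc : cost I.c (fun j : Fin n => τ j) ≤ I.C) (hl : loadNorm I.p jobs (fun j => τ j) ≤ I.L)
    {k : ℕ} (hk : k < n) : I.Eligible (extend jobs k) (τ k) := by
  constructor
  · refine le_trans ?_ hc
    unfold cost
    rw [openMachines_eq_image]
    exact Finset.single_le_sum (f := I.c) (fun _ _ => zero_le)
      (Finset.mem_image_of_mem τ (Finset.mem_range.2 hk))
  · refine le_trans ?_ (load_le hp hl (τ k))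
    rw [extend_load]
    exact Finset.single_le_sum (f := fun j => extend jobs j (τ k)) (fun _ _ => zero_le)
      (Finset.mem_filter.2 ⟨Finset.mem_range.2 hk, rfl⟩)

/-- The factor `17 * p` cancels the scaling in `size`, leaving the promised loads divided by `L`. -/
lemma promise_size {n : ℕ} (hp : 1 ≤ I.p) {jobs : Fin n → Job m} {τ : ℕ → Fin m}
    (hl : loadNorm I.p jobs (fun j => τ j) ≤ I.L) :
    ∑ i, (17 * I.p * ∑ k ∈ Finset.range n with τ k = i, I.size (extend jobs k) i) ^ I.p ≤ 1 := by
  have hp0 : 0 < I.p := by linarith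
  have hle : ∀ i, ∀ k ∈ (Finset.range n).filter (τ · = i), extend jobs k i ≤ I.L := fun i k hk => by
    refine le_trans ?_ (load_le hp hl i)
    rw [extend_load]
    exact Finset.single_le_sum (f := fun j => extend jobs j i) (fun _ _ => zero_le) hk
  have h1 : ∀ i, 17 * I.p * ∑ k ∈ Finset.range n with τ k = i, I.size (extend jobs k) i =
      (load jobs (fun j => τ j) i / I.L).toReal := fun i => by
    rw [extend_load, ENNReal.toReal_div, ENNReal.toReal_sum fun k hk =>
      ne_top_of_le_ne_top ENNReal.coe_ne_top (hle i k hk), Finset.mul_sum, Finset.sum_div]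
    refine Finset.sum_congr rfl fun k _ => ?_
    rw [size, ENNReal.toReal_div]
    field_simp
  simp only [h1, ENNReal.toReal_rpow]
  have hdiv : ∀ i, (load jobs (fun j => τ j) i / I.L) ≤ 1 := fun i =>
    ENNReal.div_le_of_le_mul (by simpa using load_le hp hl i)
  rw [← ENNReal.toReal_sum fun i _ => ne_top_of_le_ne_top ENNReal.one_ne_top
    (ENNReal.rpow_le_one (hdiv i) hp0.le)]
  refine ENNReal.toReal_le_of_le_ofReal zero_le_one ?_
  simp only [ENNReal.div_rpow_of_nonneg _ _ hp0.le, ENNReal.ofReal_one]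
  simp only [div_eq_mul_inv, ← Finset.sum_mul]
  rw [← div_eq_mul_inv]
  exact ENNReal.div_le_of_le_mul (by simpa using sum_load_rpow_le hp hl)

/-- Holds also for the default value 0 taken when no pricing exists, so the state is nonnegative on
arbitrary inputs. -/
lemma pricing_nonneg (s : (Fin m → ℝ) × (Fin m → ℝ)) (job : Job m) (i : Fin m) :
    0 ≤ (I.pricing s job).2.1 i ∧ 0 ≤ (I.pricing s job).2.2 i := by
  unfold pricing
  split_ifs with h
  · exact ⟨h.choose_spec.share_nonneg i, h.choose_spec.surplus_nonneg i⟩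
  · simp

lemma state_nonneg (hp : 1 ≤ I.p) (jobs : ℕ → Job m) (k : ℕ) (i : Fin m) :
    0 ≤ (I.state jobs k).1 i ∧ 0 ≤ (I.state jobs k).2 i := by
  induction k with
  | zero => simp [state]
  | succ k ih =>
    have h1 := I.pricing_nonneg (I.state jobs k) (jobs k) i
    have h2 : 0 ≤ I.increment (I.state jobs k).2 (jobs k) i :=
      powInc_nonneg hp (Real.rpow_nonneg ih.2 _) (I.size_nonneg hp _ _)
    have h3 := mul_nonneg h1.1 h2
    exact ⟨add_nonneg ih.1 (add_nonneg h1.2 h3), add_nonneg ih.2 h3⟩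

lemma fracRun (hm : 0 < m) (hp : 1 ≤ I.p) (jobs : ℕ → Job m) {n : ℕ}
    (hel : ∀ k < n, ∃ i, I.Eligible (jobs k) i) :
    FracRun I.p n I.scaledCost (fun k => I.Eligible (jobs k)) (fun k => I.size (jobs k))
      (I.price jobs) (I.shares jobs) (I.surplus jobs) (fun k => (I.state jobs k).1)
      (fun k => (I.state jobs k).2) where
  one_le_p := hp
  κ_pos := I.scaledCost_pos hm
  q_nonneg k := I.size_nonneg hp _
  P_zero i := rfl
  V_zero i := rfl
  P_succ k i := rfl
  V_succ k i := rfl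
  V_nonneg k i := (I.state_nonneg hp jobs k i).2
  pricing k hk := by
    have h : ∃ w : ℝ × (Fin m → ℝ) × (Fin m → ℝ), IsPricing I.scaledCost (I.state jobs k).1
        (I.increment (I.state jobs k).2 (jobs k)) (I.Eligible (jobs k)) w.1 w.2.1 w.2.2 := by
      obtain ⟨t, z, β, h⟩ := exists_isPricing (I.scaledCost_pos hm)
        (fun i => (I.state_nonneg hp jobs k i).1)
        (fun i => powInc_nonneg hp (Real.rpow_nonneg (I.state_nonneg hp jobs k i).2 (1 / I.p))
          (I.size_nonneg hp (jobs k) i)) (hel k hk)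
      exact ⟨(t, z, β), h⟩
    have h1 : I.pricing (I.state jobs k) (jobs k) = h.choose := dif_pos h
    have h2 := h.choose_spec
    rw [← h1] at h2
    exact h2

/-! ### Bounds for a fixed pattern of open machines -/

variable (O : ℕ → Fin m → Prop)

lemma openShares_nonneg (jobs : ℕ → Job m) (k : ℕ) (i : Fin m) : 0 ≤ I.openShares jobs O k i := by
  unfold openShares
  split_ifs
  · exact (I.pricing_nonneg _ _ i).1
  · exact le_rfl

lemma openShares_le (jobs : ℕ → Job m) (k : ℕ) (i : Fin m) :
    I.openShares jobs O k i ≤ I.shares jobs k i := by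
  unfold openShares
  split_ifs
  · exact le_rfl
  · exact (I.pricing_nonneg _ _ i).1

lemma isOpen_of_openShares_pos {jobs : ℕ → Job m} {k : ℕ} {i : Fin m}
    (h : 0 < I.openShares jobs O k i) : O k i := by
  by_contra hn
  unfold openShares at h
  rw [if_neg hn] at h
  exact lt_irrefl _ h

variable [Nonempty (Fin m)] {jobs : ℕ → Job m} {n : ℕ}

lemma machine_eligible (hm : 0 < m) (hp : 1 ≤ I.p)
    (hel : ∀ k < n, ∃ i, I.Eligible (jobs k) i) {k : ℕ} (hk : k < n) :
    I.Eligible (jobs k) (I.machine jobs O k) :=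
  preferred_spec_of_imp (fun i hi => ((I.fracRun hm hp jobs hel).pricing k hk).eligible i
    (hi.2.1.trans_le (I.openShares_le O jobs k i))) (hel k hk)

lemma machine_isGreedy {k : ℕ} (h : I.Covered jobs O k) :
    I.IsGreedy jobs O (I.mainLoad jobs O k) k (I.machine jobs O k) := by
  classical
  have hne : (Finset.univ.filter fun i => 0 < I.openShares jobs O k i).Nonempty := by
    by_contra hn
    rw [Finset.not_nonempty_iff_eq_empty, Finset.filter_eq_empty_iff] at hn
    have : ∑ i, I.openShares jobs O k i ≤ 0 :=
      Finset.sum_nonpos fun i hi => not_lt.1 (hn hi)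
    unfold Covered at h
    linarith
  obtain ⟨i, hi, hmin⟩ := Finset.exists_min_image _
    (fun i => powInc I.p (I.mainLoad jobs O k i) (I.size (jobs k) i)) hne
  have hex : ∃ i, I.Covered jobs O k ∧ I.IsGreedy jobs O (I.mainLoad jobs O k) k i :=
    ⟨i, h, (Finset.mem_filter.1 hi).2, fun j hj =>
      hmin j (Finset.mem_filter.2 ⟨Finset.mem_univ j, hj⟩)⟩
  exact (preferred_spec (I.Eligible (jobs k)) hex).2

open Classical in
lemma mainLoad_succ (k : ℕ) (i : Fin m) :
    I.mainLoad jobs O (k + 1) i = I.mainLoad jobs O k i +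
      if I.Covered jobs O k ∧ I.machine jobs O k = i then I.size (jobs k) i else 0 := rfl

open Classical in
lemma mainLoad_eq_sum (k : ℕ) (i : Fin m) :
    I.mainLoad jobs O k i = ∑ j ∈ Finset.range k,
      if I.Covered jobs O j ∧ I.machine jobs O j = i then I.size (jobs j) i else 0 := by
  induction k with
  | zero => rfl
  | succ k ih => rw [mainLoad_succ, Finset.sum_range_succ, ih]

lemma mainLoad_nonneg (hp : 1 ≤ I.p) (k : ℕ) (i : Fin m) : 0 ≤ I.mainLoad jobs O k i := by
  classical
  rw [mainLoad_eq_sum]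
  refine Finset.sum_nonneg fun j _ => ?_
  split_ifs
  · exact I.size_nonneg hp _ _
  · exact le_rfl

/-- `greedy_sum_le` with the open shares. The reference values `V` come from the full shares and so
dominate the partial sums over open shares, for every pattern `O`. -/
lemma sum_mainLoad_rpow_le (hm : 0 < m) (hp : 1 ≤ I.p)
    (hel : ∀ k < n, ∃ i, I.Eligible (jobs k) i) :
    ∑ i, I.mainLoad jobs O n i ^ I.p ≤ 3 * (17 * I.p) ^ I.p * ∑ i, ∑ j ∈ Finset.range n,
      I.openShares jobs O j i * I.increment (I.state jobs j).2 (jobs j) i := by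
  classical
  have hrun := I.fracRun hm hp jobs hel
  refine greedy_sum_le hp n (fun k => I.size (jobs k)) (I.openShares jobs O)
    (fun k => (I.state jobs k).2) (I.mainLoad jobs O) (fun k => I.size_nonneg hp _)
    (fun k _ => I.openShares_nonneg O jobs k)
    (fun k hk i => (I.openShares_le O jobs k i).trans ((hrun.pricing k hk).share_le_one i))
    (fun k hk i => ?_) (fun k _ i => (I.state_nonneg hp jobs k i).2) (fun i => rfl)
    (fun k _ i => ?_) (fun k hk => ?_)
  · refine le_trans (Finset.sum_le_sum fun j _ => ?_) (hrun.V_eq_sum k i).ge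
    exact mul_le_mul_of_nonneg_right (I.openShares_le O jobs j i) (hrun.inc_nonneg j i)
  · rw [mainLoad_succ]
    have := I.size_nonneg hp (jobs k) i
    split_ifs <;> linarith
  · have hinc : ∀ i, 0 ≤ I.openShares jobs O k i *
        powInc I.p (I.mainLoad jobs O k i) (I.size (jobs k) i) := fun i =>
      mul_nonneg (I.openShares_nonneg O jobs k i)
        (powInc_nonneg hp (I.mainLoad_nonneg O hp k i) (I.size_nonneg hp _ _))
    by_cases hcov : I.Covered jobs O k
    · have hg := I.machine_isGreedy O hcov
      set i₀ := I.machine jobs O k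
      have h1 : ∀ i, I.mainLoad jobs O (k + 1) i ^ I.p = I.mainLoad jobs O k i ^ I.p +
          if i₀ = i then powInc I.p (I.mainLoad jobs O k i) (I.size (jobs k) i) else 0 := fun i => by
        rw [mainLoad_succ]
        by_cases hi : i₀ = i
        · rw [if_pos ⟨hcov, hi⟩, if_pos hi, powInc]; ring
        · rw [if_neg fun h => hi h.2, if_neg hi, add_zero, add_zero]
      simp only [h1, Finset.sum_add_distrib, Finset.sum_ite_eq, Finset.mem_univ, if_true]
      gcongr
      set a := powInc I.p (I.mainLoad jobs O k i₀) (I.size (jobs k) i₀)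
      have ha : 0 ≤ a := powInc_nonneg hp (I.mainLoad_nonneg O hp k i₀) (I.size_nonneg hp _ _)
      -- The least increment is at most the average weighted by open shares; total weight at least
      -- `1 / 2` costs the factor 2.
      have h2 : (∑ i, I.openShares jobs O k i) * a ≤ ∑ i, I.openShares jobs O k i *
          powInc I.p (I.mainLoad jobs O k i) (I.size (jobs k) i) := by
        rw [Finset.sum_mul]
        refine Finset.sum_le_sum fun i _ => ?_
        rcases (I.openShares_nonneg O jobs k i).eq_or_lt with h0 | h0
        · rw [← h0]; simp
        · exact mul_le_mul_of_nonneg_left (hg.2 i h0) h0.le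
      have h3 := mul_le_mul_of_nonneg_right hcov ha
      linarith
    · have h1 : ∀ i, I.mainLoad jobs O (k + 1) i = I.mainLoad jobs O k i := fun i => by
        rw [mainLoad_succ, if_neg fun h => hcov h.1, add_zero]
      simp only [h1]
      linarith [Finset.sum_nonneg fun i (_ : i ∈ Finset.univ) => hinc i]

-- Minkowski separates covered from uncovered jobs. The uncovered part is bounded by its `ℓ_1` norm,
-- at most `L` per job by eligibility.
open Classical in
lemma loadNorm_machine_le (hm : 0 < m) (hp : 1 ≤ I.p) (jobs : Fin n → Job m)
    (hel : ∀ k < n, ∃ i, I.Eligible (extend jobs k) i) :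
    loadNorm I.p jobs (fun j => I.machine (extend jobs) O j) ≤
      ENNReal.ofReal (17 * I.p * I.L * (∑ i, I.mainLoad (extend jobs) O n i ^ I.p) ^ (1 / I.p)) +
      ∑ k ∈ Finset.range n, if I.Covered (extend jobs) O k then 0 else (I.L : ℝ≥0∞) := by
  have hp0 : 0 < I.p := by linarith
  have hA : (0 : ℝ) ≤ 17 * I.p * I.L := by positivity
  set J := extend jobs
  set a : Fin m → ℝ≥0∞ := fun i => ENNReal.ofReal (17 * I.p * I.L * I.mainLoad J O n i) with ha
  set b : Fin m → ℝ≥0∞ := fun i => ∑ k ∈ Finset.range n,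
    if ¬ I.Covered J O k ∧ I.machine J O k = i then (I.L : ℝ≥0∞) else 0 with hb
  have h1 : ∀ i, load jobs (fun j => I.machine J O j) i ≤ a i + b i := fun i => by
    rw [extend_load, Finset.sum_filter]
    simp only [ha, hb]
    rw [mainLoad_eq_sum, Finset.mul_sum, ENNReal.ofReal_sum_of_nonneg, ← Finset.sum_add_distrib]
    · refine Finset.sum_le_sum fun k hk => ?_
      have hk' := I.machine_eligible O hm hp hel (Finset.mem_range.1 hk)
      by_cases hi : I.machine J O k = i
      · rw [if_pos hi]
        rw [hi] at hk'
        by_cases hcov : I.Covered J O k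
        · rw [if_pos ⟨hcov, hi⟩, ← I.eq_ofReal_size hp hk'.2]
          exact le_self_add
        · rw [if_neg fun h => hcov h.1, if_pos ⟨hcov, hi⟩]
          simpa using hk'.2
      · rw [if_neg hi]
        exact zero_le
    · intro k _
      refine mul_nonneg hA ?_
      split_ifs
      · exact I.size_nonneg hp _ _
      · exact le_rfl
  have h2 : (∑ i, a i ^ I.p) ^ (1 / I.p) =
      ENNReal.ofReal (17 * I.p * I.L * (∑ i, I.mainLoad J O n i ^ I.p) ^ (1 / I.p)) := by
    have h3 : ∀ i, a i ^ I.p =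
        ENNReal.ofReal ((17 * I.p * I.L) ^ I.p * I.mainLoad J O n i ^ I.p) := fun i => by
      have := I.mainLoad_nonneg O (jobs := J) hp n i
      simp only [ha]
      rw [ENNReal.ofReal_rpow_of_nonneg (mul_nonneg hA this) hp0.le, Real.mul_rpow hA this]
    have hsum : ∀ i ∈ Finset.univ, 0 ≤ I.mainLoad J O n i ^ I.p := fun i _ =>
      Real.rpow_nonneg (I.mainLoad_nonneg O hp n i) _
    simp only [h3]
    rw [← ENNReal.ofReal_sum_of_nonneg fun i hi =>
      mul_nonneg (Real.rpow_nonneg hA _) (hsum i hi), ← Finset.mul_sum,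
      ENNReal.ofReal_rpow_of_nonneg (mul_nonneg (Real.rpow_nonneg hA _) (Finset.sum_nonneg hsum))
        (by positivity), Real.mul_rpow (Real.rpow_nonneg hA _) (Finset.sum_nonneg hsum),
      ← Real.rpow_mul hA, mul_one_div_cancel hp0.ne', Real.rpow_one]
  have h4 : ∑ i, b i = ∑ k ∈ Finset.range n, if I.Covered J O k then 0 else (I.L : ℝ≥0∞) := by
    simp only [hb]
    rw [Finset.sum_comm]
    refine Finset.sum_congr rfl fun k _ => ?_
    by_cases hcov : I.Covered J O k <;> simp [hcov]
  calc loadNorm I.p jobs (fun j => I.machine J O j)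
      ≤ (∑ i, (a i + b i) ^ I.p) ^ (1 / I.p) := by
        unfold loadNorm
        gcongr with i
        exact h1 i
    _ ≤ (∑ i, a i ^ I.p) ^ (1 / I.p) + (∑ i, b i ^ I.p) ^ (1 / I.p) :=
        ENNReal.Lp_add_le _ _ _ hp
    _ ≤ _ := by
        rw [h2, ← h4]
        gcongr
        exact rpow_sum_rpow_le_sum _ _ hp

-- A used machine either serves a covered job, hence is open at some time and satisfies `U`, or
-- serves an uncovered job and costs at most `C` by eligibility.
open Classical in
lemma cost_machine_le (hm : 0 < m) (hp : 1 ≤ I.p) (jobs : Fin n → Job m)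
    (hel : ∀ k < n, ∃ i, I.Eligible (extend jobs k) i) (U : Fin m → Prop)
    (hU : ∀ k < n, ∀ i, O k i → U i) :
    (cost I.c (fun j : Fin n => I.machine (extend jobs) O j) : ℝ≥0∞) ≤
      (∑ i, if U i then ENNReal.ofReal (I.C * I.scaledCost i) else 0) +
      ∑ k ∈ Finset.range n, if I.Covered (extend jobs) O k then 0 else (I.C : ℝ≥0∞) := by
  set J := extend jobs
  set S := (Finset.range n).image fun k => I.machine J O k with hS
  set F := (Finset.range n).filter fun k => ¬ I.Covered J O k with hF
  have hel' := fun k hk => I.machine_eligible O hm hp hel (k := k) hk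
  have hsub : S ⊆ (S.filter U) ∪ F.image fun k => I.machine J O k := by
    intro i hi
    obtain ⟨k, hk, rfl⟩ := Finset.mem_image.1 hi
    rw [Finset.mem_union]
    by_cases hcov : I.Covered J O k
    · exact Or.inl (Finset.mem_filter.2 ⟨hi, hU k (Finset.mem_range.1 hk) _
        (I.isOpen_of_openShares_pos O (I.machine_isGreedy O hcov).1)⟩)
    · exact Or.inr (Finset.mem_image_of_mem _ (Finset.mem_filter.2 ⟨hk, hcov⟩))
  unfold cost
  rw [openMachines_eq_image, ENNReal.ofNNReal_finsetSum]
  calc ∑ i ∈ S, (I.c i : ℝ≥0∞)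
      ≤ ∑ i ∈ (S.filter U) ∪ F.image fun k => I.machine J O k, (I.c i : ℝ≥0∞) :=
        Finset.sum_le_sum_of_subset hsub
    _ ≤ ∑ i ∈ S.filter U, (I.c i : ℝ≥0∞) +
        ∑ i ∈ F.image fun k => I.machine J O k, (I.c i : ℝ≥0∞) := by
        rw [← Finset.sum_union_inter]
        exact le_self_add
    _ ≤ _ := by
        refine add_le_add ?_ ?_
        · rw [Finset.sum_filter]
          refine (Finset.sum_le_sum fun i hi => ?_).trans
            (Finset.sum_le_sum_of_subset (Finset.subset_univ S))
          obtain ⟨k, hk, rfl⟩ := Finset.mem_image.1 hi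
          split_ifs
          · rw [← ENNReal.ofReal_coe_nnreal]
            exact ENNReal.ofReal_le_ofReal
              (I.cost_le_scaledCost (hel' k (Finset.mem_range.1 hk)).1)
          · exact le_rfl
        · calc ∑ i ∈ F.image fun k => I.machine J O k, (I.c i : ℝ≥0∞)
              ≤ ∑ k ∈ F, (I.c (I.machine J O k) : ℝ≥0∞) :=
                Finset.sum_image_le_of_nonneg fun _ _ => zero_le
            _ ≤ ∑ k ∈ F, (I.C : ℝ≥0∞) := by
                refine Finset.sum_le_sum fun k hk => ?_
                exact_mod_cast (hel' k (Finset.mem_range.1 (Finset.mem_filter.1 hk).1)).1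
            _ = _ := by
                rw [hF, Finset.sum_filter]
                refine Finset.sum_congr rfl fun k _ => ?_
                by_cases hcov : I.Covered J O k <;> simp [hcov]

end Params

/-! ### Expectations and constants -/

lemma lintegral_sum_ite {Ω ι : Type*} [MeasurableSpace Ω] (μ : Measure Ω) (s : Finset ι)
    (A : ι → Ω → Prop)
    [∀ k θ, Decidable (A k θ)] (hA : ∀ k, MeasurableSet {θ | A k θ}) (w : ι → ℝ≥0∞) :
    ∫⁻ θ, ∑ k ∈ s, (if A k θ then w k else 0) ∂μ = ∑ k ∈ s, w k * μ {θ | A k θ} := by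
  rw [lintegral_finsetSum]
  · refine Finset.sum_congr rfl fun k _ => ?_
    rw [← lintegral_indicator_const (hA k)]
    refine lintegral_congr fun θ => ?_
    by_cases h : A k θ <;> simp [h]
  · intro k _
    exact Measurable.ite (hA k) measurable_const measurable_const

lemma measurable_sum_ite {Ω ι : Type*} [MeasurableSpace Ω] (s : Finset ι)
    (A : ι → Ω → Prop)
    [∀ k θ, Decidable (A k θ)] (hA : ∀ k, MeasurableSet {θ | A k θ}) (w : ι → ℝ≥0∞) :
    Measurable fun θ => ∑ k ∈ s, if A k θ then w k else 0 :=
  Finset.measurable_fun_sum _ fun k _ => Measurable.ite (hA k) measurable_const measurable_const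

/-- Each term is `(m * (k + 1)) ^ (-2)`, at most `1 / ((k + 1) * (k + 2))` as `m ≥ 2`, and the
latter telescopes. The growth of the level with `k` thus replaces knowledge of `n`. -/
lemma sum_exp_neg_log_le {m : ℕ} (hm : 2 ≤ m) (n : ℕ) :
    ∑ k ∈ Finset.range n, Real.exp (-(8 * Real.log (m * (k + 1)) / 4)) ≤ 1 := by
  have hm' : (2 : ℝ) ≤ m := by exact_mod_cast hm
  have h1 : ∀ k : ℕ, Real.exp (-(8 * Real.log (m * (k + 1)) / 4)) ≤
      1 / ((k : ℝ) + 1) - 1 / ((k : ℝ) + 1 + 1) := fun k => by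
    have hk : (0 : ℝ) ≤ k := Nat.cast_nonneg k
    have hy : (0 : ℝ) < m * (k + 1) := by positivity
    have h2 : Real.exp (-(8 * Real.log (m * (k + 1)) / 4)) = ((m * (k + 1) : ℝ) ^ 2)⁻¹ := by
      rw [Real.exp_neg, show 8 * Real.log (m * (k + 1)) / 4 =
        Real.log (m * (k + 1)) + Real.log (m * (k + 1)) by ring, Real.exp_add, Real.exp_log hy, sq]
    have h3 : 1 / ((k : ℝ) + 1) - 1 / ((k : ℝ) + 1 + 1) = (((k : ℝ) + 1) * (k + 2))⁻¹ := by
      field_simp; ring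
    rw [h2, h3]
    refine inv_anti₀ (by positivity) ?_
    have : (2 * (k + 1) : ℝ) ^ 2 ≤ (m * (k + 1) : ℝ) ^ 2 := by gcongr
    nlinarith
  have h4 : ∑ k ∈ Finset.range n, (1 / ((k : ℝ) + 1) - 1 / ((k : ℝ) + 1 + 1)) =
      1 - 1 / ((n : ℝ) + 1) := by
    have := Finset.sum_range_sub' (fun k : ℕ => 1 / ((k : ℝ) + 1)) n
    simpa using this
  have h5 : 0 ≤ 1 / ((n : ℝ) + 1) := by positivity
  linarith [Finset.sum_le_sum fun k (_ : k ∈ Finset.range n) => h1 k]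

lemma half_le_log {y : ℝ} (hy : 2 ≤ y) : 1 / 2 ≤ Real.log y := by
  have h1 := Real.log_le_log (by norm_num) hy
  have h2 := Real.log_two_gt_d9
  linarith

namespace Params

variable {m : ℕ} (I : Params m) {n : ℕ}

open Classical in
lemma openShares_pattern (jobs : ℕ → Job m) (θ : Fin m → unitInterval) (k : ℕ) (i : Fin m) :
    I.openShares jobs (I.pattern jobs θ) k i =
      if (θ i : ℝ) ≤ 8 * Real.log (m * (k + 1)) *
        opening m (I.scaledCost i) ((I.state jobs (k + 1)).1 i) then I.shares jobs k i else 0 := rfl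

lemma measurableSet_not_covered (jobs : ℕ → Job m) (k : ℕ) :
    MeasurableSet {θ | ¬ I.Covered jobs (I.pattern jobs θ) k} := by
  classical
  unfold Covered
  simp only [openShares_pattern, not_le]
  refine measurableSet_lt (Finset.measurable_fun_sum _ fun i _ => ?_) measurable_const
  exact Measurable.ite (measurableSet_apply_le i _) measurable_const measurable_const

lemma eight_log_le {k : ℕ} (hm : 2 ≤ m) (hk : k < n) :
    8 * Real.log (m * (k + 1)) ≤ 8 * Real.log (m * n) := by
  have hm' : (2 : ℝ) ≤ m := by exact_mod_cast hm
  have hk' : (k : ℝ) + 1 ≤ n := by exact_mod_cast hk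
  have : (0 : ℝ) ≤ k := Nat.cast_nonneg k
  gcongr

lemma eight_log_ge (hm : 2 ≤ m) (k : ℕ) : 2 ≤ 8 * Real.log (m * (k + 1)) := by
  have hm' : (2 : ℝ) ≤ m := by exact_mod_cast hm
  have hk : (0 : ℝ) ≤ k := Nat.cast_nonneg k
  have := half_le_log (y := m * (k + 1)) (by nlinarith)
  linarith

lemma sum_volume_not_covered_le (hm : 2 ≤ m) (hp : 1 ≤ I.p) {jobs : ℕ → Job m}
    (hel : ∀ k < n, ∃ i, I.Eligible (jobs k) i) :
    ∑ k ∈ Finset.range n, volume {θ | ¬ I.Covered jobs (I.pattern jobs θ) k} ≤ 1 := by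
  have hrun := I.fracRun (by omega) hp jobs hel
  calc ∑ k ∈ Finset.range n, volume {θ | ¬ I.Covered jobs (I.pattern jobs θ) k}
      ≤ ∑ k ∈ Finset.range n,
          ENNReal.ofReal (Real.exp (-(8 * Real.log (m * (k + 1)) / 4))) := by
        refine Finset.sum_le_sum fun k hk => ?_
        have hpr := hrun.pricing k (Finset.mem_range.1 hk)
        have h := volume_openShare_lt_le (eight_log_ge hm k)
          (fun i => opening_nonneg m (I.scaledCost i) ((I.state jobs (k + 1)).1 i))
          (fun i => opening_le_one m (I.scaledCost i) ((I.state jobs (k + 1)).1 i))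
          hpr.share_nonneg hpr.share_le_one hpr.one_le
        unfold Covered
        simp only [openShares_pattern, not_le]
        convert h
    _ = ENNReal.ofReal (∑ k ∈ Finset.range n,
          Real.exp (-(8 * Real.log (m * (k + 1)) / 4))) :=
        (ENNReal.ofReal_sum_of_nonneg fun _ _ => (Real.exp_pos _).le).symm
    _ ≤ 1 := by
        rw [← ENNReal.ofReal_one]
        exact ENNReal.ofReal_le_ofReal (sum_exp_neg_log_le hm n)

lemma level_nonneg (hm : 2 ≤ m) (jobs : ℕ → Job m) (k : ℕ) (i : Fin m) :
    0 ≤ I.level jobs k i :=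
  mul_nonneg (by linarith [eight_log_ge hm k]) (opening_nonneg _ _ _)

variable [Nonempty (Fin m)]

lemma expectedCost_le (hm : 2 ≤ m) (hp : 1 ≤ I.p) (hn : 1 ≤ n) (jobs : Fin n → Job m)
    (τ : ℕ → Fin m) (hc : cost I.c (fun j : Fin n => τ j) ≤ I.C)
    (hl : loadNorm I.p jobs (fun j => τ j) ≤ I.L) :
    I.algorithm.expectedCost I.c jobs ≤
      ENNReal.ofReal (90 * (Real.log m * Real.log (m * n))) * I.C := by
  classical
  have hm0 : 0 < m := by omega
  have hm' : (2 : ℝ) ≤ m := by exact_mod_cast hm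
  have hn' : (1 : ℝ) ≤ n := by exact_mod_cast hn
  set J := extend jobs
  have hel : ∀ k < n, ∃ i, I.Eligible (J k) i := fun k hk => ⟨_, I.promise_eligible hp hc hl hk⟩
  have hrun := I.fracRun hm0 hp J hel
  have hT := hrun.sum_price_le τ (fun k hk => I.promise_eligible hp hc hl hk)
    (I.promise_scaledCost hm0 hc) (I.promise_size hp hl)
  have hcost := hrun.sum_scaled_cost_le hm0 (I.scaledCost_le_two hm0) le_rfl
  set x : Fin m → ℝ := fun i => opening m (I.scaledCost i) ((I.state J n).1 i) with hx
  set Λ := Real.log (m * n)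
  have hΛ : 1 / 2 ≤ Λ := half_le_log (by nlinarith)
  have hΛ0 : 0 ≤ Λ := by linarith
  have hlogm : 1 / 2 ≤ Real.log m := half_le_log hm'
  -- Levels are dominated by the final opening with factor `8 * Λ`, so one event per machine covers
  -- all times and no union over jobs is needed.
  have hU : ∀ θ : Fin m → unitInterval, ∀ k < n, ∀ i, I.pattern J θ k i →
      (θ i : ℝ) ≤ 8 * Λ * x i := fun θ k hk i hi => by
    refine hi.trans ?_
    unfold level
    refine mul_le_mul (eight_log_le hm hk) ?_ (opening_nonneg _ _ _) (by positivity)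
    exact opening_mono (I.scaledCost_pos hm0 i) (hrun.P_le hk le_rfl i)
  have hx0 : ∀ i, 0 ≤ 8 * Λ * x i := fun i => mul_nonneg (by linarith) (opening_nonneg _ _ _)
  have hCκ : ∀ i, 0 ≤ (I.C : ℝ) * I.scaledCost i := fun i =>
    mul_nonneg I.C.2 (I.scaledCost_pos hm0 i).le
  have hbound : ∀ θ : Fin m → unitInterval,
      (cost I.c (I.algorithm.schedule jobs θ) : ℝ≥0∞) ≤
      (∑ i, if (θ i : ℝ) ≤ 8 * Λ * x i then ENNReal.ofReal (I.C * I.scaledCost i) else 0) +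
      ∑ k ∈ Finset.range n, if ¬ I.Covered J (I.pattern J θ) k then (I.C : ℝ≥0∞) else 0 :=
    fun θ => by
    have h := I.cost_machine_le (I.pattern J θ) hm0 hp jobs hel
      (fun i => (θ i : ℝ) ≤ 8 * Λ * x i) (hU θ)
    simp only [ite_not]
    convert h using 4
    rename_i j
    exact I.schedule_algorithm jobs θ j
  have hfirst : ∑ i, ENNReal.ofReal (I.C * I.scaledCost i) *
      volume {θ : Fin m → unitInterval | (θ i : ℝ) ≤ 8 * Λ * x i} ≤
      ENNReal.ofReal (8 * Λ * (2 + Real.log m * 6)) * I.C := by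
    calc _ ≤ ∑ i, ENNReal.ofReal (8 * Λ * (I.scaledCost i * x i)) * I.C := by
          refine Finset.sum_le_sum fun i _ => ?_
          refine (mul_le_mul_right (volume_apply_le i (hx0 i)) _).trans (le_of_eq ?_)
          have hκx : 0 ≤ 8 * Λ * (I.scaledCost i * x i) := by
            have := mul_nonneg (I.scaledCost_pos hm0 i).le
              (opening_nonneg m (I.scaledCost i) ((I.state J n).1 i))
            exact mul_nonneg (by linarith) this
          rw [← ENNReal.ofReal_coe_nnreal, ← ENNReal.ofReal_mul (hCκ i),
            ← ENNReal.ofReal_mul hκx]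
          congr 1; ring
      _ = ENNReal.ofReal (8 * Λ * ∑ i, I.scaledCost i * x i) * I.C := by
          rw [← Finset.sum_mul, Finset.mul_sum, ENNReal.ofReal_sum_of_nonneg]
          intro i _
          exact mul_nonneg (by linarith) (mul_nonneg (I.scaledCost_pos hm0 i).le
            (opening_nonneg _ _ _))
      _ ≤ _ := by
          gcongr
          refine hcost.trans ?_
          gcongr
  calc I.algorithm.expectedCost I.c jobs
      ≤ ∫⁻ θ : Fin m → unitInterval,
        ((∑ i, if (θ i : ℝ) ≤ 8 * Λ * x i then ENNReal.ofReal (I.C * I.scaledCost i) else 0) +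
        ∑ k ∈ Finset.range n, if ¬ I.Covered J (I.pattern J θ) k then (I.C : ℝ≥0∞) else 0) :=
        lintegral_mono hbound
    _ = ∑ i, ENNReal.ofReal (I.C * I.scaledCost i) *
          volume {θ : Fin m → unitInterval | (θ i : ℝ) ≤ 8 * Λ * x i} +
        ∑ k ∈ Finset.range n, I.C * volume {θ | ¬ I.Covered J (I.pattern J θ) k} := by
        rw [lintegral_add_left (measurable_sum_ite _ (fun i (θ : Fin m → unitInterval) =>
            (θ i : ℝ) ≤ 8 * Λ * x i) (fun i => measurableSet_apply_le i _) _),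
          lintegral_sum_ite _ _ (fun i (θ : Fin m → unitInterval) => (θ i : ℝ) ≤ 8 * Λ * x i)
            (fun i => measurableSet_apply_le i _),
          lintegral_sum_ite _ _ (fun k θ => ¬ I.Covered J (I.pattern J θ) k)
            (fun k => I.measurableSet_not_covered J k)]
    _ ≤ ENNReal.ofReal (8 * Λ * (2 + Real.log m * 6)) * I.C + ENNReal.ofReal 1 * I.C := by
        refine add_le_add hfirst ?_
        rw [← Finset.mul_sum, mul_comm, ENNReal.ofReal_one]
        gcongr
        exact I.sum_volume_not_covered_le hm hp hel
    _ = ENNReal.ofReal (8 * Λ * (2 + Real.log m * 6) + 1) * I.C := by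
        rw [← add_mul, ← ENNReal.ofReal_add (by positivity) zero_le_one]
    _ ≤ _ := by
        gcongr
        nlinarith [mul_nonneg (sub_nonneg.2 hΛ) (sub_nonneg.2 hlogm), mul_nonneg hΛ0 (sub_nonneg.2 hlogm)]

lemma rpow_one_div_le_one_add {p y : ℝ} (hp : 1 ≤ p) (hy : 0 ≤ y) : y ^ (1 / p) ≤ 1 + y := by
  have hp0 : 0 < p := by linarith
  calc y ^ (1 / p) ≤ (1 + y) ^ (1 / p) := Real.rpow_le_rpow hy (by linarith) (by positivity)
    _ ≤ (1 + y) ^ (1 : ℝ) := Real.rpow_le_rpow_of_exponent_le (by linarith)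
        ((div_le_one hp0).2 hp)
    _ = 1 + y := Real.rpow_one _

lemma half_le_rpow_one_div {p y : ℝ} (hp : 1 ≤ p) (hy : 1 / 2 ≤ y) : 1 / 2 ≤ y ^ (1 / p) := by
  have hp0 : 0 < p := by linarith
  calc (1 / 2 : ℝ) = (1 / 2 : ℝ) ^ (1 : ℝ) := (Real.rpow_one _).symm
    _ ≤ (1 / 2 : ℝ) ^ (1 / p) := Real.rpow_le_rpow_of_exponent_ge (by norm_num) (by norm_num)
        ((div_le_one hp0).2 hp)
    _ ≤ _ := Real.rpow_le_rpow (by norm_num) hy (by positivity)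

lemma expectedLoadNorm_le (hm : 2 ≤ m) (hp : 1 ≤ I.p) (hn : 1 ≤ n) (jobs : Fin n → Job m)
    (τ : ℕ → Fin m) (hc : cost I.c (fun j : Fin n => τ j) ≤ I.C)
    (hl : loadNorm I.p jobs (fun j => τ j) ≤ I.L) :
    I.algorithm.expectedLoadNorm I.p jobs ≤
      ENNReal.ofReal (100000 * (I.p ^ 2 * Real.log (m * n) ^ (1 / I.p))) * I.L := by
  classical
  have hp0 : 0 < I.p := by linarith
  have hm0 : 0 < m := by omega
  have hm' : (2 : ℝ) ≤ m := by exact_mod_cast hm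
  have hn' : (1 : ℝ) ≤ n := by exact_mod_cast hn
  set J := extend jobs
  have hel : ∀ k < n, ∃ i, I.Eligible (J k) i := fun k hk => ⟨_, I.promise_eligible hp hc hl hk⟩
  have hrun := I.fracRun hm0 hp J hel
  have hT := hrun.sum_price_le τ (fun k hk => I.promise_eligible hp hc hl hk)
    (I.promise_scaledCost hm0 hc) (I.promise_size hp hl)
  have hΦ := hrun.sum_opening_inc_le.trans hT
  set Λ := Real.log (m * n)
  have hΛ : 1 / 2 ≤ Λ := half_le_log (by nlinarith)
  have hΛ0 : 0 < Λ := by linarith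
  set w : ℕ → Fin m → ℝ := fun k i => I.shares J k i * I.increment (I.state J k).2 (J k) i with hw
  have hw0 : ∀ k i, 0 ≤ w k i := fun k i => mul_nonneg (I.pricing_nonneg _ _ i).1
    (powInc_nonneg hp (Real.rpow_nonneg (I.state_nonneg hp J k i).2 _) (I.size_nonneg hp _ _))
  -- Here `48 * Λ` bounds the expected open increments: `8 * Λ` from the levels times the total
  -- price 6. The 3 from the greedy bound makes it 144.
  set R := 17 * I.p * (144 * Λ) ^ (1 / I.p) with hR
  have hR0 : 0 < R := by positivity
  set A := 17 * I.p * R with hA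
  have hA0 : 0 < A := by positivity
  have hRp : R ^ I.p = (17 * I.p) ^ I.p * (144 * Λ) := by
    rw [hR, Real.mul_rpow (by positivity) (by positivity), ← Real.rpow_mul (by positivity),
      one_div_mul_cancel hp0.ne', Real.rpow_one]
  have hbound : ∀ θ : Fin m → unitInterval,
      loadNorm I.p jobs (I.algorithm.schedule jobs θ) ≤
      (ENNReal.ofReal (A * I.L) + ∑ i, ∑ k ∈ Finset.range n, if (θ i : ℝ) ≤ I.level J k i then
        ENNReal.ofReal (A * I.L * (w k i / (48 * Λ))) else 0) +
      ∑ k ∈ Finset.range n, if ¬ I.Covered J (I.pattern J θ) k then (I.L : ℝ≥0∞) else 0 :=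
    fun θ => by
    have h := I.loadNorm_machine_le (I.pattern J θ) hm0 hp jobs hel
    have hs : I.algorithm.schedule jobs θ = fun j : Fin n => I.machine J (I.pattern J θ) j :=
      funext fun j => I.schedule_algorithm jobs θ j
    rw [hs]
    simp only [ite_not]
    refine h.trans (add_le_add_left ?_ _)
    have hM := I.sum_mainLoad_rpow_le (I.pattern J θ) hm0 hp hel
    set S := ∑ i, I.mainLoad J (I.pattern J θ) n i ^ I.p
    have hS : 0 ≤ S := Finset.sum_nonneg fun i _ =>
      Real.rpow_nonneg (I.mainLoad_nonneg _ hp n i) _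
    set Y := ∑ i, ∑ k ∈ Finset.range n,
      I.openShares J (I.pattern J θ) k i * I.increment (I.state J k).2 (J k) i with hY
    have hY0 : 0 ≤ Y := Finset.sum_nonneg fun i _ => Finset.sum_nonneg fun k _ =>
      mul_nonneg (I.openShares_nonneg _ J k i) (hrun.inc_nonneg k i)
    -- Normalizing `Y` by the bound on its mean before applying `y ^ (1 / p) ≤ 1 + y` replaces
    -- Jensen's inequality and leaves an expression linear in the threshold indicators.
    have h1 : S ^ (1 / I.p) ≤ R * (1 + Y / (48 * Λ)) := by
      calc S ^ (1 / I.p) ≤ (R ^ I.p * (Y / (48 * Λ))) ^ (1 / I.p) := by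
            refine Real.rpow_le_rpow hS (hM.trans (le_of_eq ?_)) (by positivity)
            rw [hRp]; field_simp; ring
        _ = R * (Y / (48 * Λ)) ^ (1 / I.p) := by
            rw [Real.mul_rpow (by positivity) (by positivity), ← Real.rpow_mul hR0.le,
              mul_one_div_cancel hp0.ne', Real.rpow_one]
        _ ≤ _ := by
            gcongr
            exact rpow_one_div_le_one_add hp (by positivity)
    have h2 : 17 * I.p * I.L * S ^ (1 / I.p) ≤ A * I.L + ∑ i, ∑ k ∈ Finset.range n,
        if (θ i : ℝ) ≤ I.level J k i then A * I.L * (w k i / (48 * Λ)) else 0 := by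
      calc 17 * I.p * I.L * S ^ (1 / I.p) ≤ 17 * I.p * I.L * (R * (1 + Y / (48 * Λ))) := by gcongr
        _ = A * I.L + A * I.L / (48 * Λ) * Y := by rw [hA]; ring
        _ = _ := by
            rw [hY, Finset.mul_sum]
            congr 1
            refine Finset.sum_congr rfl fun i _ => ?_
            rw [Finset.mul_sum]
            refine Finset.sum_congr rfl fun k _ => ?_
            change _ * ((if (θ i : ℝ) ≤ I.level J k i then I.shares J k i else 0) * _) = _
            split_ifs
            · rw [hw]; ring
            · ring
    have hterm : ∀ i k, 0 ≤
        if (θ i : ℝ) ≤ I.level J k i then A * I.L * (w k i / (48 * Λ)) else 0 := fun i k => by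
      have := hw0 k i
      split_ifs <;> positivity
    refine (ENNReal.ofReal_le_ofReal h2).trans (le_of_eq ?_)
    rw [ENNReal.ofReal_add (by positivity) (Finset.sum_nonneg fun i _ =>
      Finset.sum_nonneg fun k _ => hterm i k), ENNReal.ofReal_sum_of_nonneg fun i _ =>
      Finset.sum_nonneg fun k _ => hterm i k]
    congr 1
    refine Finset.sum_congr rfl fun i _ => ?_
    rw [ENNReal.ofReal_sum_of_nonneg fun k _ => hterm i k]
    refine Finset.sum_congr rfl fun k _ => ?_
    split_ifs <;> simp
  have hmid : ∑ i, ∑ k ∈ Finset.range n, ENNReal.ofReal (A * I.L * (w k i / (48 * Λ))) *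
      volume {θ : Fin m → unitInterval | (θ i : ℝ) ≤ I.level J k i} ≤
      ENNReal.ofReal (A * I.L) := by
    have hAw : ∀ k i, 0 ≤ A * I.L * (w k i / (48 * Λ)) := fun k i => by
      have := hw0 k i
      positivity
    calc _ ≤ ∑ i, ∑ k ∈ Finset.range n, ENNReal.ofReal (A * I.L * (w k i / (48 * Λ)) *
            I.level J k i) := by
          refine Finset.sum_le_sum fun i _ => Finset.sum_le_sum fun k _ => ?_
          rw [ENNReal.ofReal_mul (hAw k i)]
          gcongr
          exact volume_apply_le i (I.level_nonneg hm J k i)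
      _ = ENNReal.ofReal (∑ i, ∑ k ∈ Finset.range n, A * I.L * (w k i / (48 * Λ)) *
            I.level J k i) := by
          have h0 : ∀ k i, 0 ≤ A * I.L * (w k i / (48 * Λ)) * I.level J k i := fun k i =>
            mul_nonneg (hAw k i) (I.level_nonneg hm J k i)
          rw [ENNReal.ofReal_sum_of_nonneg fun i _ => Finset.sum_nonneg fun k _ => h0 k i]
          refine Finset.sum_congr rfl fun i _ => ?_
          rw [ENNReal.ofReal_sum_of_nonneg fun k _ => h0 k i]
      _ ≤ ENNReal.ofReal (A * I.L) := by
          refine ENNReal.ofReal_le_ofReal ?_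
          calc _ ≤ ∑ i, ∑ k ∈ Finset.range n, A * I.L / 6 *
                (opening m (I.scaledCost i) ((I.state J (k + 1)).1 i) * w k i) := by
                refine Finset.sum_le_sum fun i _ => Finset.sum_le_sum fun k hk => ?_
                have h1 : I.level J k i ≤ 8 * Λ *
                    opening m (I.scaledCost i) ((I.state J (k + 1)).1 i) :=
                  mul_le_mul_of_nonneg_right (eight_log_le hm (Finset.mem_range.1 hk))
                    (opening_nonneg _ _ _)
                refine (mul_le_mul_of_nonneg_left h1 (hAw k i)).trans (le_of_eq ?_)
                field_simp
                ring
            _ = A * I.L / 6 * ∑ i, ∑ k ∈ Finset.range n,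
                opening m (I.scaledCost i) ((I.state J (k + 1)).1 i) * w k i := by
                simp only [Finset.mul_sum]
            _ ≤ A * I.L / 6 * 6 := by
                gcongr
                exact hΦ
            _ = A * I.L := by ring
  have hmeas : ∀ i, Measurable fun θ : Fin m → unitInterval => ∑ k ∈ Finset.range n,
      if (θ i : ℝ) ≤ I.level J k i then ENNReal.ofReal (A * I.L * (w k i / (48 * Λ))) else 0 :=
    fun i => measurable_sum_ite _ (fun k (θ : Fin m → unitInterval) => (θ i : ℝ) ≤ I.level J k i)
      (fun k => measurableSet_apply_le i _) _
  calc I.algorithm.expectedLoadNorm I.p jobs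
      ≤ ∫⁻ θ : Fin m → unitInterval, ((ENNReal.ofReal (A * I.L) +
        ∑ i, ∑ k ∈ Finset.range n, if (θ i : ℝ) ≤ I.level J k i then
          ENNReal.ofReal (A * I.L * (w k i / (48 * Λ))) else 0) +
        ∑ k ∈ Finset.range n, if ¬ I.Covered J (I.pattern J θ) k then (I.L : ℝ≥0∞) else 0) :=
        lintegral_mono hbound
    _ = (ENNReal.ofReal (A * I.L) + ∑ i, ∑ k ∈ Finset.range n,
          ENNReal.ofReal (A * I.L * (w k i / (48 * Λ))) *
          volume {θ : Fin m → unitInterval | (θ i : ℝ) ≤ I.level J k i}) +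
        ∑ k ∈ Finset.range n, I.L * volume {θ | ¬ I.Covered J (I.pattern J θ) k} := by
        have hmeas' : Measurable fun θ : Fin m → unitInterval => ENNReal.ofReal (A * I.L) +
            ∑ i, ∑ k ∈ Finset.range n, if (θ i : ℝ) ≤ I.level J k i then
              ENNReal.ofReal (A * I.L * (w k i / (48 * Λ))) else 0 :=
          measurable_const.add (Finset.measurable_fun_sum _ fun i _ => hmeas i)
        rw [lintegral_add_left hmeas', lintegral_add_left measurable_const,
          lintegral_finsetSum _ fun i _ => hmeas i,
          lintegral_sum_ite _ _ (fun k θ => ¬ I.Covered J (I.pattern J θ) k)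
            (fun k => I.measurableSet_not_covered J k), lintegral_const, measure_univ, mul_one]
        congr 2
        refine Finset.sum_congr rfl fun i _ => ?_
        exact lintegral_sum_ite _ _ (fun k (θ : Fin m → unitInterval) =>
          (θ i : ℝ) ≤ I.level J k i) (fun k => measurableSet_apply_le i _) _
    _ ≤ (ENNReal.ofReal (A * I.L) + ENNReal.ofReal (A * I.L)) + ENNReal.ofReal 1 * I.L := by
        refine add_le_add (add_le_add_right hmid _) ?_
        rw [← Finset.mul_sum, mul_comm, ENNReal.ofReal_one]
        gcongr
        exact I.sum_volume_not_covered_le hm hp hel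
    _ = ENNReal.ofReal (2 * A + 1) * I.L := by
        rw [← ENNReal.ofReal_add (by positivity) (by positivity), ← ENNReal.ofReal_coe_nnreal,
          ← ENNReal.ofReal_mul zero_le_one, ← ENNReal.ofReal_add (by positivity) (by positivity),
          ← ENNReal.ofReal_mul (by positivity)]
        congr 1; ring
    _ ≤ _ := by
        gcongr
        -- Then `2 * A` is at most `2 * 17 ^ 2 * 144 = 83232` times the target, and the remaining 1
        -- is absorbed because `Λ ^ (1 / p) ≥ 1 / 2`.
        have h1 : (144 * Λ) ^ (1 / I.p) ≤ 144 * Λ ^ (1 / I.p) := by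
          rw [Real.mul_rpow (by norm_num) hΛ0.le]
          gcongr
          calc (144 : ℝ) ^ (1 / I.p) ≤ 144 ^ (1 : ℝ) :=
                Real.rpow_le_rpow_of_exponent_le (by norm_num) ((div_le_one hp0).2 hp)
            _ = 144 := Real.rpow_one _
        have h2 := half_le_rpow_one_div hp hΛ
        have h3 : 1 ≤ I.p ^ 2 := one_le_pow₀ hp
        have h4 : A ≤ 17 * I.p * (17 * I.p * (144 * Λ ^ (1 / I.p))) := by
          rw [hA, hR]; gcongr
        have h5 : Λ ^ (1 / I.p) ≤ I.p ^ 2 * Λ ^ (1 / I.p) := le_mul_of_one_le_left (by linarith) h3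
        nlinarith

end Params

end UMSC

theorem theorem4 :
    ∃ K₁ K₂ : ℝ, 0 < K₁ ∧ 0 < K₂ ∧
      ∀ p : ℝ, 1 ≤ p →
        ∃ alg : (m : ℕ) → (2 ≤ m) → (c : Fin m → ℝ≥0) → (C L : ℝ≥0) →
            UMSC.RandomizedOnlineAlgorithm m,
          ∀ (m : ℕ) (hm : 2 ≤ m) (c : Fin m → ℝ≥0) (C L : ℝ≥0)
            (n : ℕ) (jobs : Fin n → UMSC.Job m),
            1 ≤ n → UMSC.Promise c p C L jobs →
              (alg m hm c C L).expectedCost c jobs ≤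
                  ENNReal.ofReal (K₁ * (Real.log m * Real.log (m * n))) * C ∧
              (alg m hm c C L).expectedLoadNorm p jobs ≤
                  ENNReal.ofReal (K₂ * (p ^ 2 * Real.log (m * n) ^ (1 / p))) * L := by
  refine ⟨90, 100000, by norm_num, by norm_num, fun p hp =>
    ⟨fun m hm c C L =>
      haveI : Nonempty (Fin m) := ⟨⟨0, by omega⟩⟩
      UMSC.Params.algorithm ⟨p, c, C, L⟩, fun m hm c C L n jobs hn hpr => ?_⟩⟩
  have : Nonempty (Fin m) := ⟨⟨0, by omega⟩⟩
  obtain ⟨τ, hc, hl⟩ := hpr.exists_nat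
  exact ⟨UMSC.Params.expectedCost_le ⟨p, c, C, L⟩ hm hp hn jobs τ hc hl,
    UMSC.Params.expectedLoadNorm_le ⟨p, c, C, L⟩ hm hp hn jobs τ hc hl⟩
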